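/- **Scenarios and models.** A measurement scenario $S$ consists of a finite set $X_S$ of measurements, finite non-empty outcome sets $O_{S,x}$ ($x\in X_S$), and a simplicial complex $\Sigma_S$ on $X_S$ (a downward closed family of subsets containing $\emptyset$ and all singletons; its members are called contexts). Put $\mathcal E_S(U)=\prod_{x\in U}O_{S,x}$ for $U\subseteq X_S$. A probabilistic (resp. possibilistic) model $e$ on $S$ is a family of probability distributions (resp. non-empty subsets) $e_\sigma$ on (resp. of) $\mathcal E_S(\sigma)$, $\sigma\in\Sigma_S$, compatible with restriction: $e_\tau=e_\sigma|_\tau$ for $\tau\subseteq\sigma$. The possibilistic collapse of a probabilistic model is its family of supports. **Procedures.** A deterministic procedure $f=(\pi,\alpha):S\to T$ is a relation assigning to each $x\in X_T$ a set $\pi(x)\subseteq X_S$, such that $\pi(\sigma)=\bigcup_{x\in\sigma}\pi(x)\in\Sigma_S$ for all $\sigma\in\Sigma_T$, together with functions $\alpha_x:\mathcal E_S(\pi(x))\to O_{T,x}$; these glue to $\alpha_U:\mathcal E_S(\pi(U))\to\mathcal E_T(U)$. Procedures compose by composing the relations and the functions. A probabilistic (resp. possibilistic) procedure is a probability distribution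 on (resp. a non-empty subset of) the finite set of deterministic procedures $S\to T$, written $\sum_i r_if_i$ (resp. $\bigvee_i f_i$); composition is extended bilinearly. A deterministic procedure acts on models by $(f e)_\sigma=(\alpha_\sigma)_*(e_{\pi(\sigma)})$ (push-forward of distributions, resp. direct image of subsets), and mixtures act linearly. **Predicates.** Let $\mathbf 2$ be the scenario with one measurement and outcomes $0,1$. A possibilistic model $e$ on $S$ satisfies a possibilistic procedure $g:S\to\mathbf 2$ (a predicate) if $g e$ is the model on $\mathbf 2$ of the certain outcome $1$; a probabilistic model satisfies $g$ if its collapse does. A possibilistic model $e$ induces the predicate $g(e)=\bigvee_{\sigma\in\Sigma_S}g(e)_\sigma$, where $g(e)_\sigma$ measures $\sigma$ and returns $1$ iff the joint outcome lies in $e_\sigma$; $e$ is determined by $g(e)$. **The categories.** Objects of $\mathbf{Scen}^g$ and of $\mathbf{Scen}^g_{\mathbb B}$ are pairs $\langle S,g\rangle$ with $S$ a scenario and $g$ a predicate on $S$ induced by a possibilistic model (whose subset at $\sigma$ is written $g_\sigma$). A morphism $\langle S,g\rangle\to\langle T,h\rangle$ of $\mathbf{Scen}^g_{\mathbb B}$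 is a possibilistic procedure $F:S\to T$ such that $F e$ satisfies $h$ for every possibilistic model $e$ satisfying $g$. A morphism of $\mathbf{Scen}^g$ is a probabilistic procedure $\sum_i r_if_i$ (all $r_i>0$) whose collapse $\bigvee_i f_i$ is a morphism of $\mathbf{Scen}^g_{\mathbb B}$. **Internal hom.** $[S,T]$ is the scenario with measurements $X_T$, contexts $\Sigma_T$ and outcomes at $x$ the pairs $(U,k)$ with $U\subseteq X_S$ and $k:\mathcal E_S(U)\to O_{T,x}$. The object $[\langle S,g\rangle,\langle T,h\rangle]$ is $[S,T]$ with the predicate induced by the model which at $\sigma\in\Sigma_T$ consists of the families $(U_x,k_x)_{x\in\sigma}$ such that $U=\bigcup_{x\in\sigma} U_x\in\Sigma_S$ and $(k_x(s|_{U_x}))_{x\in\sigma}\in h_\sigma$ for all $s\in g_U$. The unit is $\langle 0,\mathsf t\rangle$: the empty scenario with the always satisfied predicate. On deterministic procedures define: * $[\mathrm{id},f]:[P,S]\to[P,T]$ for $f=(\pi,\alpha):S\to T$, with relation $\pi$ and, at $x$, $(U_y,k_y)_{y\in\pi(x)}\mapsto\bigl(V,\ p\mapsto \alpha_x((k_y(p|_{U_y}))_y)\bigr)$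 where $V=\bigcup_yU_y$; * $[f,\mathrm{id}]:[T,P]\to[S,P]$, with identity relation and $(U,k)\mapsto(\pi(U),k\circ\alpha_U)$; and $[f,g]=[\mathrm{id},g]\circ[f,\mathrm{id}]$; * $i_S:S\to[0,S]$, with identity relation and $o\mapsto(\emptyset,*\mapsto o)$; * $j_S:0\to[S,S]$, with empty relation, picking $(\{x\},\mathrm{id})$ at $x$; * $L^P_{S,T}:[S,T]\to[[P,S],[P,T]]$, with identity relation and $(U,k)\mapsto\bigl(U,\ (V_y,m_y)_{y\in U}\mapsto(\bigcup_yV_y,\ p\mapsto k((m_y(p|_{V_y}))_y))\bigr)$. **Theorem.** With the internal hom objects and the unit above, $\mathbf{Scen}^g$ and $\mathbf{Scen}^g_{\mathbb B}$ are closed categories. The bifunctor acts on morphisms by convex (resp. Boolean) bilinear extension, $$\Bigl[\sum_i r_if_i,\ \sum_j s_jg_j\Bigr]=\sum_{i,j}r_is_j[f_i,g_j],\qquad \Bigl[\bigvee_i f_i,\ \bigvee_j g_j\Bigr]=\bigvee_{i,j}[f_i,g_j],$$ and the structure maps are the deterministic $i$, $j$, $L$ above. That is: $[-,-]$ is a well-defined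 bifunctor $\mathcal C^{\mathrm{op}}\times\mathcal C\to\mathcal C$; the maps $i_A:A\to[1,A]$ form a natural isomorphism; the maps $j_A:1\to[A,A]$ are dinatural in $A$; the maps $L^A_{B,D}:[B,D]\to[[A,B],[A,D]]$ are natural in $B,D$ and dinatural in $A$; and (compositions in diagrammatic order) 1. $j_B\,;\,L^A_{B,B}=j_{[A,B]}$; 2. $L^A_{A,B}\,;\,[j_A,1]=i_{[A,B]}$; 3. $L^A_{D,E}\,;\,L^{[A,B]}_{[A,D],[A,E]}\,;\,[L^A_{B,D},1]=L^B_{D,E}\,;\,[1,L^A_{B,E}]$; 4. $L^1_{A,B}\,;\,[i_A,1]=[1,i_B]$; 5. $f\mapsto j_A\,;\,[1,f]$ is a bijection from $\mathcal C(A,B)$ onto $\mathcal C(1,[A,B])$. Moreover, when $g$ is induced by the possibilistic collapse of some probabilistic model, a probabilistic procedure $p:S\to T$ is a morphism $\langle S,g\rangle\to\langle T,h\rangle$ of $\mathbf{Scen}^g$ if and only if $p\,e$ satisfies $h$ for every probabilistic model $e$ satisfying $g$. -/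

import Mathlib

open CategoryTheory

universe u v

namespace ClosedScen

/-! ### Closed categories -/

/-- A closed category structure on `C` (in the axiomatisation with CC1-CC5 due to Laplaza, Street
and Manzyuk) with prescribed unit object `one` and prescribed internal hom objects `ihom A B`:
the action of the bifunctor `[-,-] : Cᵒᵖ × C ⥤ C` on morphisms, a natural isomorphism
`i_A : A ≅ [1, A]`, a dinatural family `j_A : 1 ⟶ [A, A]`, and a family
`L^A_{B,D} : [B, D] ⟶ [[A, B], [A, D]]` natural in `B`, `D` and dinatural in `A`. -/
structure ClosedStructure (C : Type u) [Category.{v} C] (one : C) (ihom : C → C → C) where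
  map : ∀ {A A' B B' : C}, (A' ⟶ A) → (B ⟶ B') → (ihom A B ⟶ ihom A' B')
  map_id : ∀ A B : C, map (𝟙 A) (𝟙 B) = 𝟙 (ihom A B)
  map_comp : ∀ {A A' A'' B B' B'' : C} (f : A' ⟶ A) (f' : A'' ⟶ A') (g : B ⟶ B') (g' : B' ⟶ B''),
    map (f' ≫ f) (g ≫ g') = map f g ≫ map f' g'
  i : ∀ A : C, A ≅ ihom one A
  i_natural : ∀ {A B : C} (f : A ⟶ B), f ≫ (i B).hom = (i A).hom ≫ map (𝟙 one) f
  j : ∀ A : C, one ⟶ ihom A A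
  j_dinatural : ∀ {A B : C} (f : A ⟶ B), j A ≫ map (𝟙 A) f = j B ≫ map f (𝟙 B)
  L : ∀ A B D : C, ihom B D ⟶ ihom (ihom A B) (ihom A D)
  L_natural : ∀ (A : C) {B B' D D' : C} (f : B' ⟶ B) (g : D ⟶ D'),
    L A B D ≫ map (map (𝟙 A) f) (map (𝟙 A) g) = map f g ≫ L A B' D'
  L_dinatural : ∀ {A A' : C} (f : A' ⟶ A) (B D : C),
    L A B D ≫ map (𝟙 (ihom A B)) (map f (𝟙 D)) =
      L A' B D ≫ map (map f (𝟙 B)) (𝟙 (ihom A' D))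
  CC1 : ∀ A B : C, j B ≫ L A B B = j (ihom A B)
  CC2 : ∀ A B : C, L A A B ≫ map (j A) (𝟙 (ihom A B)) = (i (ihom A B)).hom
  CC3 : ∀ A B D E : C,
    L A D E ≫ L (ihom A B) (ihom A D) (ihom A E) ≫
        map (L A B D) (𝟙 (ihom (ihom A B) (ihom A E))) =
      L B D E ≫ map (𝟙 (ihom B D)) (L A B E)
  CC4 : ∀ A B : C,
    L one A B ≫ map (i A).hom (𝟙 (ihom one B)) = map (𝟙 A) (i B).hom
  CC5 : ∀ A B : C, Function.Bijective fun f : A ⟶ B => j A ≫ map (𝟙 A) f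

/-! ### Measurement scenarios -/

/-- A measurement scenario: a finite set `X` of measurements, a finite non-empty set `O x` of
outcomes for each of them, and a simplicial complex `ctx` of measurement contexts. -/
structure Scenario where
  X : Type u
  [finX : Finite X]
  O : X → Type u
  [finO : ∀ x, Finite (O x)]
  [neO : ∀ x, Nonempty (O x)]
  ctx : Set (Set X)
  empty_mem : ∅ ∈ ctx
  singleton_mem : ∀ x, {x} ∈ ctx
  down_closed : ∀ {σ τ : Set X}, σ ∈ ctx → τ ⊆ σ → τ ∈ ctx

attribute [instance] Scenario.finX Scenario.finO Scenario.neO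

/-- Joint outcome assignments `∏ x ∈ U, O x`. -/
abbrev Scenario.Ev (S : Scenario.{u}) (U : Set S.X) : Type u := ∀ x, x ∈ U → S.O x

instance (S : Scenario.{u}) (U : Set S.X) : Finite (S.Ev U) :=
  inferInstanceAs (Finite (∀ x, x ∈ U → S.O x))

def Scenario.restrict (S : Scenario.{u}) {U V : Set S.X} (h : U ⊆ V) (s : S.Ev V) : S.Ev U :=
  fun x hx => s x (h hx)

/-! ### Deterministic procedures -/

/-- A deterministic procedure `S → T`: a simplicial relation `π = rel` from the contexts of `T` to
those of `S`, and functions `α_x = act x : Ev_S (π x) → O_{T,x}`. -/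
structure DetProc (S T : Scenario.{u}) where
  rel : T.X → Set S.X
  simplicial : ∀ σ ∈ T.ctx, {y | ∃ x ∈ σ, y ∈ rel x} ∈ S.ctx
  act : ∀ x, S.Ev (rel x) → T.O x

namespace DetProc

variable {S T V W : Scenario.{u}}

/-- The image `π U` of a set of measurements. -/
def image (f : DetProc S T) (U : Set T.X) : Set S.X := {y | ∃ x ∈ U, y ∈ f.rel x}

/-- The map `α_U : Ev_S (π U) → Ev_T U` glued from the `α_x`. -/
def evMap (f : DetProc S T) (U : Set T.X) (s : S.Ev (f.image U)) : T.Ev U :=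
  fun x hx => f.act x (fun y hy => s y ⟨x, hx, hy⟩)

/-- The image of a context, as a context. -/
abbrev imageCtx (f : DetProc S T) (σ : T.ctx) : S.ctx := ⟨f.image σ, f.simplicial σ σ.2⟩

theorem ext' {f g : DetProc S T} (h : ∀ x, f.rel x = g.rel x)
    (h' : ∀ x (s : S.Ev (f.rel x)) (t : S.Ev (g.rel x)),
      (∀ y hy hy', s y hy = t y hy') → f.act x s = g.act x t) : f = g := by
  obtain ⟨r, hr, a⟩ := f
  obtain ⟨r', hr', a'⟩ := g
  obtain rfl : r = r' := funext h
  congr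
  funext x s
  exact h' x s s fun _ _ _ => rfl

def id (S : Scenario.{u}) : DetProc S S where
  rel x := {x}
  simplicial σ hσ := by simpa using hσ
  act x s := s x rfl

/-- First `f : S → T`, then `g : T → V`. -/
def comp (f : DetProc S T) (g : DetProc T V) : DetProc S V where
  rel x := f.image (g.rel x)
  simplicial σ hσ := by
    refine S.down_closed (f.simplicial _ (g.simplicial σ hσ)) ?_
    rintro y ⟨x, hx, z, hz, hy⟩
    exact ⟨z, ⟨x, hx, hz⟩, hy⟩
  act x s := g.act x (f.evMap (g.rel x) s)

theorem id_comp (f : DetProc S T) : (id S).comp f = f := by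
  refine ext' (fun x => ?_) (fun x s t h => ?_)
  · ext y; simp [comp, image, id]
  · exact congrArg (f.act x) (funext fun y => funext fun hy => h _ _ _)

theorem comp_id (f : DetProc S T) : f.comp (id T) = f := by
  refine ext' (fun x => ?_) (fun x s t h => ?_)
  · ext y; simp [comp, image, id]
  · exact congrArg (f.act x) (funext fun y => funext fun hy => h _ _ _)

theorem comp_assoc (f : DetProc S T) (g : DetProc T V) (k : DetProc V W) :
    (f.comp g).comp k = f.comp (g.comp k) := by
  refine ext' (fun x => ?_) (fun x s t h => ?_)
  · ext y
    constructor
    · rintro ⟨a, ha, b, hb, hy⟩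
      exact ⟨b, ⟨a, ha, hb⟩, hy⟩
    · rintro ⟨b, ⟨a, ha, hb⟩, hy⟩
      exact ⟨a, ha, b, hb, hy⟩
  · refine congrArg (k.act x) (funext fun a => funext fun ha => ?_)
    refine congrArg (g.act a) (funext fun b => funext fun hb => ?_)
    exact congrArg (f.act b) (funext fun y => funext fun hy => h _ _ _)

end DetProc

/-! ### Possibilistic procedures and models -/

/-- Boolean distributions on `α`, that is, non-empty subsets. -/
abbrev BoolDist (α : Type u) : Type u := {F : Set α // F.Nonempty}

namespace BoolDist

variable {α β : Type u}

def pure (a : α) : BoolDist α := ⟨{a}, Set.singleton_nonempty a⟩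

/-- The Boolean mixture `⋁_{a ∈ F} G a`. -/
def bind (F : BoolDist α) (G : α → BoolDist β) : BoolDist β :=
  ⟨⋃ a ∈ F.1, (G a).1, by
    obtain ⟨a, ha⟩ := F.2
    obtain ⟨b, hb⟩ := (G a).2
    exact ⟨b, Set.mem_biUnion ha hb⟩⟩

end BoolDist

/-- The support of a probability distribution. -/
def collapse {α : Type u} (p : PMF α) : BoolDist α := ⟨p.support, p.support_nonempty⟩

/-- A possibilistic empirical model: a compatible family of non-empty sets of joint outcomes. -/
structure PossModel (S : Scenario.{u}) where
  supp : ∀ σ : S.ctx, Set (S.Ev σ)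
  nonempty : ∀ σ, (supp σ).Nonempty
  compat : ∀ (σ τ : S.ctx) (h : (τ : Set S.X) ⊆ σ), supp τ = S.restrict h '' supp σ

/-- A probabilistic empirical model: a compatible family of probability distributions. -/
structure ProbModel (S : Scenario.{u}) where
  dist : ∀ σ : S.ctx, PMF (S.Ev σ)
  compat : ∀ (σ τ : S.ctx) (h : (τ : Set S.X) ⊆ σ), dist τ = (dist σ).map (S.restrict h)

theorem PossModel.ext' {S : Scenario.{u}} {d e : PossModel S}
    (h : ∀ σ, d.supp σ = e.supp σ) : d = e := by
  obtain ⟨a, _, _⟩ := d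
  obtain ⟨b, _, _⟩ := e
  obtain rfl : a = b := funext h
  rfl

theorem PossModel.mem_restrict {S : Scenario.{u}} (e : PossModel S) {σ τ : S.ctx}
    (h : (τ : Set S.X) ⊆ σ) {s : S.Ev σ} (hs : s ∈ e.supp σ) : S.restrict h s ∈ e.supp τ := by
  rw [e.compat σ τ h]
  exact ⟨s, hs, rfl⟩

section push

variable {S T V : Scenario.{u}}

theorem DetProc.imageCtx_mono (f : DetProc S T) {σ τ : T.ctx} (h : (τ : Set T.X) ⊆ σ) :
    (f.imageCtx τ : Set S.X) ⊆ f.imageCtx σ := by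
  rintro y ⟨x, hx, hy⟩
  exact ⟨x, h hx, hy⟩

/-- `EMP_𝔹(⋁ f_i) e = ⋁ EMP_𝔹(f_i) e`, where `(EMP_𝔹(f) e)_σ` is the image of `e_{π σ}`
under `α_σ`. -/
def PossModel.push (F : BoolDist (DetProc S T)) (e : PossModel S) : PossModel T where
  supp σ := ⋃ f ∈ F.1, f.evMap σ '' e.supp (f.imageCtx σ)
  nonempty σ := by
    obtain ⟨f, hf⟩ := F.2
    obtain ⟨s, hs⟩ := e.nonempty (f.imageCtx σ)
    exact ⟨_, Set.mem_biUnion hf ⟨s, hs, rfl⟩⟩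
  compat σ τ h := by
    rw [Set.image_iUnion₂]
    refine Set.iUnion₂_congr fun f _ => ?_
    rw [e.compat (f.imageCtx σ) (f.imageCtx τ) (f.imageCtx_mono h), Set.image_image, Set.image_image]
    rfl

/-- `EMP(∑ r_i f_i) e = ∑ r_i EMP(f_i) e`, where `(EMP(f) e)_σ` is the push-forward of `e_{π σ}`
along `α_σ`. -/
noncomputable def ProbModel.push (p : PMF (DetProc S T)) (e : ProbModel S) : ProbModel T where
  dist σ := p.bind fun f => (e.dist (f.imageCtx σ)).map (f.evMap σ)
  compat σ τ h := by
    rw [PMF.map_bind]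
    congr 1
    funext f
    rw [e.compat (f.imageCtx σ) (f.imageCtx τ) (f.imageCtx_mono h), PMF.map_comp, PMF.map_comp]
    rfl

/-- The possibilistic collapse of a probabilistic model. -/
noncomputable def ProbModel.collapse (e : ProbModel S) : PossModel S where
  supp σ := (e.dist σ).support
  nonempty σ := (e.dist σ).support_nonempty
  compat σ τ h := by rw [e.compat σ τ h, PMF.support_map]

/-- The deterministic model given by a global assignment. -/
def PossModel.delta (s : ∀ x, S.O x) : PossModel S where
  supp σ := {(fun x _ => s x : S.Ev σ)}
  nonempty _ := Set.singleton_nonempty _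
  compat σ τ h := by
    rw [Set.image_singleton]
    rfl

/-- Composition of possibilistic procedures, extended from deterministic ones by Boolean
linearity. -/
def possComp (F : BoolDist (DetProc S T)) (G : BoolDist (DetProc T V)) : BoolDist (DetProc S V) :=
  F.bind fun f => G.bind fun g => BoolDist.pure (f.comp g)

/-- Composition of probabilistic procedures, extended from deterministic ones by convex
linearity. -/
noncomputable def probComp (p : PMF (DetProc S T)) (q : PMF (DetProc T V)) : PMF (DetProc S V) :=
  p.bind fun f => q.bind fun g => PMF.pure (f.comp g)

theorem mem_possComp {F : BoolDist (DetProc S T)} {G : BoolDist (DetProc T V)}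
    {k : DetProc S V} : k ∈ (possComp F G).1 ↔ ∃ f ∈ F.1, ∃ g ∈ G.1, k = f.comp g := by
  simp [possComp, BoolDist.bind, BoolDist.pure]

theorem collapse_probComp (p : PMF (DetProc S T)) (q : PMF (DetProc T V)) :
    collapse (probComp p q) = possComp (collapse p) (collapse q) := by
  refine Subtype.ext (Set.ext fun k => ?_)
  rw [mem_possComp]
  simp [collapse, probComp]

theorem collapse_pure {α : Type u} (a : α) : collapse (PMF.pure a) = BoolDist.pure a :=
  Subtype.ext (PMF.support_pure a)

theorem PossModel.push_id (e : PossModel S) : e.push (BoolDist.pure (DetProc.id S)) = e := by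
  refine PossModel.ext' fun σ => ?_
  have h : (σ : Set S.X) ⊆ ((DetProc.id S).imageCtx σ : Set S.X) := fun x hx => ⟨x, hx, rfl⟩
  rw [e.compat _ σ h]
  simp only [PossModel.push, BoolDist.pure, Set.mem_singleton_iff, Set.iUnion_iUnion_eq_left]
  rfl

theorem PossModel.push_comp (e : PossModel S) (F : BoolDist (DetProc S T))
    (G : BoolDist (DetProc T V)) : e.push (possComp F G) = (e.push F).push G := by
  refine PossModel.ext' fun σ => Set.ext fun t => ?_
  simp only [PossModel.push, Set.mem_iUnion, exists_prop, mem_possComp]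
  constructor
  · rintro ⟨_, ⟨f, hf, g, hg, rfl⟩, s, hs, rfl⟩
    have h : (f.imageCtx (g.imageCtx σ) : Set S.X) ⊆ (f.comp g).imageCtx σ := by
      rintro y ⟨z, ⟨x, hx, hz⟩, hy⟩
      exact ⟨x, hx, z, hz, hy⟩
    exact ⟨g, hg, _, Set.mem_biUnion hf ⟨_, e.mem_restrict h hs, rfl⟩, rfl⟩
  · rintro ⟨g, hg, _, hm, rfl⟩
    obtain ⟨f, hf, s, hs, rfl⟩ := Set.mem_iUnion₂.1 hm
    have h : ((f.comp g).imageCtx σ : Set S.X) ⊆ f.imageCtx (g.imageCtx σ) := by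
      rintro y ⟨x, hx, z, hz, hy⟩
      exact ⟨z, ⟨x, hx, hz⟩, hy⟩
    exact ⟨_, ⟨f, hf, g, hg, rfl⟩, _, e.mem_restrict h hs, rfl⟩

end push

/-! ### Predicates -/

/-- The scenario `𝟚` with a single measurement and two outcomes. -/
abbrev two : Scenario.{u} where
  X := PUnit
  O _ := ULift Bool
  ctx := Set.univ
  empty_mem := trivial
  singleton_mem _ := trivial
  down_closed _ _ := trivial

section predicates

variable {S : Scenario.{u}}

open Classical in
/-- The deterministic predicate `S → 𝟚` which measures the context `σ` and checks whether the joint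
outcome lies in `A`. -/
noncomputable def detPred (σ : S.ctx) (A : Set (S.Ev σ)) : DetProc S two where
  rel _ := σ
  simplicial τ _ := S.down_closed σ.2 (by rintro y ⟨_, _, hy⟩; exact hy)
  act _ s := ULift.up (decide (s ∈ A))

/-- The predicate `g(e) = ⋁_σ g(e)_σ` induced by a possibilistic model `e`. -/
noncomputable def PossModel.pred (e : PossModel S) : BoolDist (DetProc S two) :=
  ⟨Set.range fun σ : S.ctx => detPred σ (e.supp σ), ⟨_, ⟨∅, S.empty_mem⟩, rfl⟩⟩

/-- `e` satisfies `g` if `EMP_𝔹(g) e` is the model on `𝟚` of the deterministic outcome `1`. -/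
def PossModel.Satisfies (e : PossModel S) (g : BoolDist (DetProc S two)) : Prop :=
  e.push g = PossModel.delta fun _ => ULift.up true

/-- A probabilistic model satisfies `g` if its possibilistic collapse does. -/
def ProbModel.Satisfies (e : ProbModel S) (g : BoolDist (DetProc S two)) : Prop :=
  e.collapse.Satisfies g

/-- A possibilistic model is determined by the predicate that it induces. -/
theorem PossModel.pred_injective : Function.Injective (PossModel.pred (S := S)) := by
  intro d e h
  refine PossModel.ext' fun σ => ?_
  have h1 : detPred σ (d.supp σ) ∈ e.pred.1 := h ▸ ⟨σ, rfl⟩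
  obtain ⟨τ, hτ⟩ := h1
  have h2 : τ = σ := Subtype.ext (congrFun (congrArg DetProc.rel hτ) PUnit.unit)
  subst h2
  have h3 : (detPred τ (e.supp τ)).act = (detPred τ (d.supp τ)).act := by
    injection hτ
  ext s
  have h4 := congrArg ULift.down (congrFun (congrFun h3 PUnit.unit) s)
  simp only [detPred, decide_eq_decide] at h4
  exact h4.symm

end predicates

/-- A pair `⟨S, g⟩` of a scenario and a structure predicate induced by a possibilistic model. As
this model is determined by `g` (see `PossModel.pred_injective`), it is used to record `g`. -/
structure GScenario where
  scen : Scenario.{u}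
  model : PossModel scen

/-- The structure predicate. -/
noncomputable def GScenario.pred (A : GScenario.{u}) : BoolDist (DetProc A.scen two) := A.model.pred

/-! ### The categories of scenarios with structure predicates -/

/-- The possibilistic procedure `F` takes possibilistic models that satisfy the structure predicate
of `A` to models that satisfy that of `B`. -/
def Preserves (A B : GScenario.{u}) (F : BoolDist (DetProc A.scen B.scen)) : Prop :=
  ∀ e : PossModel A.scen, e.Satisfies A.pred → (e.push F).Satisfies B.pred

/-- A possibilistic procedure that preserves the structure predicates. -/
@[ext]
structure PossHom (A B : GScenario.{u}) where
  proc : BoolDist (DetProc A.scen B.scen)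
  preserves : Preserves A B proc

/-- A probabilistic procedure whose possibilistic collapse preserves the structure predicates (by
`GScenario.model`, this can be checked context by context). -/
@[ext]
structure ProbHom (A B : GScenario.{u}) where
  proc : PMF (DetProc A.scen B.scen)
  preserves : Preserves A B (collapse proc)

theorem preserves_id (A : GScenario.{u}) : Preserves A A (BoolDist.pure (DetProc.id A.scen)) := by
  intro e he
  rwa [e.push_id]

theorem Preserves.comp {A B D : GScenario.{u}} {F : BoolDist (DetProc A.scen B.scen)}
    {G : BoolDist (DetProc B.scen D.scen)} (hF : Preserves A B F) (hG : Preserves B D G) :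
    Preserves A D (possComp F G) := by
  intro e he
  rw [e.push_comp]
  exact hG _ (hF _ he)

/-- Scenarios with structure predicates and probabilistic procedures. -/
def ScenProb : Type (u + 1) := GScenario.{u}

/-- Scenarios with structure predicates and possibilistic procedures. -/
def ScenPoss : Type (u + 1) := GScenario.{u}

noncomputable instance : Category.{u} ScenProb.{u} where
  Hom A B := ProbHom A B
  id A := ⟨PMF.pure (DetProc.id A.scen), by rw [collapse_pure]; exact preserves_id A⟩
  comp f g := ⟨probComp f.proc g.proc, by
    rw [collapse_probComp]; exact f.preserves.comp g.preserves⟩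
  id_comp f := by
    refine ProbHom.ext ?_
    simp [probComp, DetProc.id_comp]
  comp_id f := by
    refine ProbHom.ext ?_
    simp [probComp, DetProc.comp_id]
  assoc f g h := by
    refine ProbHom.ext ?_
    simp [probComp, DetProc.comp_assoc]

instance : Category.{u} ScenPoss.{u} where
  Hom A B := PossHom A B
  id A := ⟨BoolDist.pure (DetProc.id A.scen), preserves_id A⟩
  comp f g := ⟨possComp f.proc g.proc, f.preserves.comp g.preserves⟩
  id_comp f := by
    refine PossHom.ext (Subtype.ext (Set.ext fun k => ?_))
    simp [mem_possComp, BoolDist.pure, DetProc.id_comp]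
  comp_id f := by
    refine PossHom.ext (Subtype.ext (Set.ext fun k => ?_))
    simp [mem_possComp, BoolDist.pure, DetProc.comp_id]
  assoc f g h := by
    refine PossHom.ext (Subtype.ext (Set.ext fun k => ?_))
    simp only [mem_possComp]
    constructor
    · rintro ⟨_, ⟨a, ha, b, hb, rfl⟩, c, hc, rfl⟩
      exact ⟨a, ha, _, ⟨b, hb, c, hc, rfl⟩, DetProc.comp_assoc a b c⟩
    · rintro ⟨a, ha, _, ⟨b, hb, c, hc, rfl⟩, rfl⟩
      exact ⟨_, ⟨a, ha, b, hb, rfl⟩, c, hc, (DetProc.comp_assoc a b c).symm⟩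

/-! ### The unit and the internal hom -/

/-- The empty scenario. -/
abbrev zero : Scenario.{u} where
  X := PEmpty
  O x := x.elim
  finO x := x.elim
  neO x := x.elim
  ctx := Set.univ
  empty_mem := trivial
  singleton_mem _ := trivial
  down_closed _ _ := trivial

/-- The unit object: the empty scenario with the predicate that is always satisfied. -/
def unit : GScenario.{u} where
  scen := zero
  model :=
    { supp := fun _ => Set.univ
      nonempty := fun _ => ⟨fun x => PEmpty.elim x, trivial⟩
      compat := fun σ τ h => by
        have hs : ∀ ρ : Set zero.{u}.X, Subsingleton (zero.{u}.Ev ρ) := fun ρ =>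
          ⟨fun s t => funext fun x => PEmpty.elim x⟩
        refine (Set.eq_univ_of_forall fun s => ?_).symm
        exact ⟨fun x => PEmpty.elim x, trivial, (hs _).elim _ _⟩ }

/-- The scenario `[S, T]`, with the measurements and contexts of `T`; an outcome at `x` is a set
`U` of measurements of `S` together with a function `Ev_S U → O_{T,x}`. -/
abbrev homScen (S T : Scenario.{u}) : Scenario.{u} where
  X := T.X
  O x := Σ U : Set S.X, (S.Ev U → T.O x)
  neO _ := ⟨⟨∅, fun _ => Classical.arbitrary _⟩⟩
  ctx := T.ctx
  empty_mem := T.empty_mem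
  singleton_mem := T.singleton_mem
  down_closed := T.down_closed

section homScen

variable {P S T : Scenario.{u}} {σ : Set T.X}

/-- The union `⋃_{x ∈ σ} U_x` for a family `k = ⟨U_x, k_x⟩_{x ∈ σ}`. -/
def outUnion (k : (homScen S T).Ev σ) : Set S.X := {y | ∃ x, ∃ hx : x ∈ σ, y ∈ (k x hx).1}

/-- The function `s ↦ (k_x (s|U_x))_{x ∈ σ}` for a family `k = ⟨U_x, k_x⟩_{x ∈ σ}`. -/
def outApply (k : (homScen S T).Ev σ) (s : S.Ev (outUnion k)) : T.Ev σ :=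
  fun x hx => (k x hx).2 fun y hy => s y ⟨x, hx, hy⟩

end homScen

/-- The object `[A, B]`: its structure predicate allows at the context `σ` the families
`⟨U_x, k_x⟩_{x ∈ σ}` such that `⋃ U_x` is a context and every joint outcome there allowed by `A` is
mapped to one allowed by `B`. -/
def homObj (A B : GScenario.{u}) : GScenario.{u} where
  scen := homScen A.scen B.scen
  model :=
    have ext_aux : ∀ (σ τ : B.scen.ctx) (h : (τ : Set B.scen.X) ⊆ σ)
        (k : (homScen A.scen B.scen).Ev τ),
        (∃ hU : outUnion k ∈ A.scen.ctx, ∀ s ∈ A.model.supp ⟨outUnion k, hU⟩,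
          outApply k s ∈ B.model.supp τ) →
        ∃ k' : (homScen A.scen B.scen).Ev σ,
          (∃ hU : outUnion k' ∈ A.scen.ctx, ∀ s ∈ A.model.supp ⟨outUnion k', hU⟩,
            outApply k' s ∈ B.model.supp σ) ∧ (homScen A.scen B.scen).restrict h k' = k := by
      classical
      rintro σ τ h k ⟨hU, hk⟩
      have hex : ∀ s : A.scen.Ev (outUnion k), ∃ t : B.scen.Ev σ,
          s ∈ A.model.supp ⟨outUnion k, hU⟩ →
            t ∈ B.model.supp σ ∧ B.scen.restrict h t = outApply k s := by
        intro s
        by_cases hs : s ∈ A.model.supp ⟨outUnion k, hU⟩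
        · have := hk s hs
          rw [B.model.compat σ τ h] at this
          obtain ⟨t, ht, hts⟩ := this
          exact ⟨t, fun _ => ⟨ht, hts⟩⟩
        · exact ⟨fun _ _ => Classical.arbitrary _, fun h => (hs h).elim⟩
      choose t ht using hex
      let k' : (homScen A.scen B.scen).Ev σ := fun x hx =>
        if hx' : x ∈ (τ : Set B.scen.X) then k x hx' else ⟨outUnion k, fun s => t s x hx⟩
      have k'_pos : ∀ x hx (hx' : x ∈ (τ : Set B.scen.X)), k' x hx = k x hx' :=
        fun x hx hx' => dif_pos hx'
      have k'_neg : ∀ x hx (_ : x ∉ (τ : Set B.scen.X)),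
          k' x hx = ⟨outUnion k, fun s => t s x hx⟩ := fun x hx hx' => dif_neg hx'
      have hle : outUnion k' ⊆ outUnion k := by
        rintro y ⟨x, hx, hy⟩
        by_cases hx' : x ∈ (τ : Set B.scen.X)
        · rw [k'_pos x hx hx'] at hy
          exact ⟨x, hx', hy⟩
        · rw [k'_neg x hx hx'] at hy
          exact hy
      have hge : outUnion k ⊆ outUnion k' := by
        rintro y ⟨x, hx, hy⟩
        refine ⟨x, h hx, ?_⟩
        rw [k'_pos x (h hx) hx]
        exact hy
      refine ⟨k', ⟨A.scen.down_closed hU hle, fun s hs => ?_⟩, ?_⟩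
      · have hs' := A.model.mem_restrict (τ := ⟨outUnion k, hU⟩) hge hs
        obtain ⟨h1, h2⟩ := ht _ hs'
        convert h1 using 1
        funext x hx
        have key : ∀ o : (homScen A.scen B.scen).O x, k' x hx = o →
            ∀ ho : o.1 ⊆ outUnion k', outApply k' s x hx = o.2 (A.scen.restrict ho s) := by
          rintro _ rfl _
          rfl
        by_cases hx' : x ∈ (τ : Set B.scen.X)
        · rw [key _ (k'_pos x hx hx') fun y hy => hge ⟨x, hx', hy⟩]
          exact (congrFun (congrFun h2 x) hx').symm
        · rw [key _ (k'_neg x hx hx') hge]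
      · funext x hx
        exact k'_pos x (h hx) hx
    { supp := fun σ => {k | ∃ hU : outUnion k ∈ A.scen.ctx,
        ∀ s ∈ A.model.supp ⟨outUnion k, hU⟩, outApply k s ∈ B.model.supp σ}
      nonempty := fun σ => by
        obtain ⟨k, hk, _⟩ := ext_aux σ ⟨∅, B.scen.empty_mem⟩ (Set.empty_subset _)
          (fun x (hx : x ∈ (∅ : Set B.scen.X)) => hx.elim)
          ⟨by
            convert A.scen.empty_mem
            ext y
            simp [outUnion], fun s _ => by
            obtain ⟨t, ht⟩ := B.model.nonempty ⟨∅, B.scen.empty_mem⟩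
            convert ht
            funext x hx
            exact hx.elim⟩
        exact ⟨k, hk⟩
      compat := fun σ τ h => by
        refine Set.Subset.antisymm (fun k hk => ?_) ?_
        · obtain ⟨k', hk', rfl⟩ := ext_aux σ τ h k hk
          exact ⟨k', hk', rfl⟩
        · rintro _ ⟨k, ⟨hU, hk⟩, rfl⟩
          have hle : outUnion ((homScen A.scen B.scen).restrict h k) ⊆ outUnion k := by
            rintro y ⟨x, hx, hy⟩
            exact ⟨x, h hx, hy⟩
          refine ⟨A.scen.down_closed hU hle, fun s hs => ?_⟩
          rw [A.model.compat ⟨outUnion k, hU⟩ _ hle] at hs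
          obtain ⟨s, hs, rfl⟩ := hs
          exact B.model.mem_restrict h (hk s hs) }

/-! ### The structure maps, as deterministic procedures -/

namespace DetProc

/-- `[id, f] : [P, S] → [P, T]`, postcomposition with `f : S → T`. -/
def postcomp (P : Scenario.{u}) {S T : Scenario.{u}} (f : DetProc S T) :
    DetProc (homScen P S) (homScen P T) where
  rel := f.rel
  simplicial := f.simplicial
  act x k := ⟨outUnion k, fun p => f.act x (outApply k p)⟩

/-- `[f, id] : [T, P] → [S, P]`, precomposition with `f : S → T`. -/
def precomp {S T : Scenario.{u}} (f : DetProc S T) (P : Scenario.{u}) :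
    DetProc (homScen T P) (homScen S P) where
  rel x := {x}
  simplicial := (id P).simplicial
  act x k := ⟨f.image (k x rfl).1, fun s => (k x rfl).2 (f.evMap _ s)⟩

/-- `[f, g] : [S, T] → [S', T']` for `f : S' → S` and `g : T → T'`. -/
def homMap {S S' T T' : Scenario.{u}} (f : DetProc S' S) (g : DetProc T T') :
    DetProc (homScen S T) (homScen S' T') :=
  (f.precomp T).comp (g.postcomp S')

/-- `i_S : S → [0, S]` identifies outcomes with functions on the one-point set `Ev_0 ∅`. -/
def iMap (S : Scenario.{u}) : DetProc S (homScen zero S) where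
  rel x := {x}
  simplicial := (id S).simplicial
  act x s := ⟨∅, fun _ => s x rfl⟩

/-- `j_S : 0 → [S, S]` picks the identity. -/
def jMap (S : Scenario.{u}) : DetProc zero (homScen S S) where
  rel _ := ∅
  simplicial _ _ := trivial
  act x _ := ⟨{x}, fun s => s x rfl⟩

/-- `L^P_{S,T} : [S, T] → [[P, S], [P, T]]` internalises composition. -/
def LMap (P S T : Scenario.{u}) :
    DetProc (homScen S T) (homScen (homScen P S) (homScen P T)) where
  rel x := {x}
  simplicial := (id T).simplicial
  act x k := ⟨(k x rfl).1, fun m => ⟨outUnion m, fun p => (k x rfl).2 (outApply m p)⟩⟩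

end DetProc

end ClosedScen

namespace ClosedScen

/-! ### Satisfaction and preservation, context by context -/

/-! Everything reduces to deterministic procedures. A structure predicate is induced by a model, and
that model is the largest one satisfying it (`PossModel.satisfies_pred_iff`). Since pushing forward
is monotone, preservation need only be tested on this model, and since the push-forward along a
mixture is a union over its components, it can be tested one component and one context at a time
(`preserves_iff`). So a morphism of either category is a mixture of deterministic procedures
satisfying `DetPreserves`. The last claim of the theorem follows too: if the largest model is a
collapse, a single probabilistic model already tests preservation.

An outcome of `[S, T]` is a function together with the measurements it reads, and the predicate of
`[A, B]` selects the families that read a context and send allowed outcomes to allowed ones. With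
this reading, `L` is composition and `j` the identity, so the deterministic identities are the
associativity and unit laws of composition. In the closed category equations every morphism variable
occurs exactly once on each side, so they extend to mixtures by the monad laws of `PMF` and
`BoolDist`.

For CC5, a point `0 → [S, T]` is a choice of a pair `(U_x, k_x)` for each `x`, which need not be
simplicial. The predicate of `[A, B]` supplies exactly simpliciality and preservation, so the
deterministic preserving points are the names of the deterministic preserving procedures
(`exists_name`, `name_injective`). On mixtures, `f ↦ j ; [1, f]` is the push-forward along `name`.

The measurement sets of two equal composites are rarely definitionally equal. Arguments are
therefore compared pointwise where both are defined (`PossModel.mem_of_agree`, `out_ext`), which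
avoids casts. -/

theorem PossModel.mem_of_agree {S : Scenario.{u}} (e : PossModel S) {σ τ : S.ctx}
    (h : (τ : Set S.X) ⊆ σ) {s : S.Ev σ} {t : S.Ev τ} (hs : s ∈ e.supp σ)
    (hst : ∀ y hy, t y hy = s y (h hy)) : t ∈ e.supp τ := by
  obtain rfl : t = S.restrict h s := funext fun y => funext fun hy => hst y hy
  exact e.mem_restrict h hs

/-- The predicate of `e` runs one test for each context `σ`, namely membership in `e_σ`; the outcome
is certainly `1` when no possible outcome of `d` fails a test. -/
theorem PossModel.satisfies_pred_iff {S : Scenario.{u}} (d e : PossModel S) :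
    d.Satisfies e.pred ↔ ∀ σ, d.supp σ ⊆ e.supp σ := by
  classical
  have key : ∀ (σ : S.ctx) (τ : two.{u}.ctx) (s : S.Ev ((detPred σ (e.supp σ)).imageCtx τ)),
      PUnit.unit ∈ (τ : Set PUnit) → ∃ h : (σ : Set S.X) ⊆ (detPred σ (e.supp σ)).imageCtx τ,
        ((detPred σ (e.supp σ)).evMap τ s = (fun _ _ => ULift.up true) ↔
          S.restrict h s ∈ e.supp σ) := by
    intro σ τ s hτ
    refine ⟨fun y hy => ⟨_, hτ, hy⟩, fun h => ?_, fun h => ?_⟩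
    · have h1 := congrArg ULift.down (congrFun (congrFun h PUnit.unit) hτ)
      exact of_decide_eq_true h1
    · funext x hx
      exact congrArg ULift.up (decide_eq_true h)
  constructor
  · intro h σ s hs
    have hτ : (Set.univ : Set PUnit.{u + 1}) ∈ two.{u}.ctx := trivial
    have h1 := congrFun (congrArg PossModel.supp h) ⟨Set.univ, hτ⟩
    have hle : ((detPred σ (e.supp σ)).imageCtx ⟨Set.univ, hτ⟩ : Set S.X) ⊆ σ := by
      rintro y ⟨_, _, hy⟩
      exact hy
    obtain ⟨hge, h2⟩ := key σ ⟨Set.univ, hτ⟩ (S.restrict hle s) trivial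
    refine h2.1 ?_
    have h3 : (detPred σ (e.supp σ)).evMap Set.univ (S.restrict hle s) ∈
        (d.push e.pred).supp ⟨Set.univ, hτ⟩ :=
      Set.mem_biUnion (show detPred σ (e.supp σ) ∈ e.pred.1 from ⟨σ, rfl⟩)
        ⟨_, d.mem_restrict hle hs, rfl⟩
    rw [h1] at h3
    exact h3
  · intro h
    refine PossModel.ext' fun τ => ?_
    -- Non-emptiness turns the inclusion in a singleton, `hsub`, into an equality.
    obtain ⟨t, ht⟩ := (d.push e.pred).nonempty τ
    have hsub : (d.push e.pred).supp τ ⊆ {(fun _ _ => ULift.up true : two.{u}.Ev τ)} := by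
      intro t ht
      obtain ⟨_, ⟨σ, rfl⟩, s, hs, rfl⟩ := Set.mem_iUnion₂.1 ht
      by_cases hτ : PUnit.unit ∈ (τ : Set PUnit)
      · obtain ⟨hge, h2⟩ := key σ τ s hτ
        exact h2.2 (h σ (d.mem_restrict hge hs))
      · exact funext fun x => funext fun hx => (hτ hx).elim
    refine Set.Subset.antisymm hsub ?_
    rintro _ rfl
    have h3 := hsub ht
    rw [Set.mem_singleton_iff] at h3
    rwa [← h3]

/-- A deterministic procedure maps joint outcomes allowed by `A` to ones allowed by `B`. -/
def DetPreserves (A B : GScenario.{u}) (f : DetProc A.scen B.scen) : Prop :=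
  ∀ (σ : B.scen.ctx), ∀ s ∈ A.model.supp (f.imageCtx σ), f.evMap σ s ∈ B.model.supp σ

theorem preserves_of_push_model {A B : GScenario.{u}} {F : BoolDist (DetProc A.scen B.scen)}
    (h : (A.model.push F).Satisfies B.pred) : ∀ f ∈ F.1, DetPreserves A B f := by
  intro f hf σ s hs
  exact (PossModel.satisfies_pred_iff _ _).1 h σ (Set.mem_biUnion hf ⟨s, hs, rfl⟩)

theorem GScenario.model_satisfies (A : GScenario.{u}) : A.model.Satisfies A.pred :=
  (PossModel.satisfies_pred_iff _ _).2 fun _ => subset_rfl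

/-- The model of `A` satisfies its own predicate and contains every other model that does, so it is
the only one to test. -/
theorem preserves_iff {A B : GScenario.{u}} {F : BoolDist (DetProc A.scen B.scen)} :
    Preserves A B F ↔ ∀ f ∈ F.1, DetPreserves A B f := by
  refine ⟨fun h => preserves_of_push_model (h _ A.model_satisfies), fun h e he => ?_⟩
  refine (PossModel.satisfies_pred_iff _ _).2 fun σ t ht => ?_
  obtain ⟨f, hf, s, hs, rfl⟩ := Set.mem_iUnion₂.1 ht
  exact h f hf σ s ((PossModel.satisfies_pred_iff _ _).1 he _ hs)

theorem preserves_pure {A B : GScenario.{u}} {f : DetProc A.scen B.scen} :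
    Preserves A B (BoolDist.pure f) ↔ DetPreserves A B f := by
  rw [preserves_iff]
  exact forall_eq

theorem DetPreserves.comp {A B D : GScenario.{u}} {f : DetProc A.scen B.scen}
    {g : DetProc B.scen D.scen} (hf : DetPreserves A B f) (hg : DetPreserves B D g) :
    DetPreserves A D (f.comp g) :=
  preserves_iff.1 ((preserves_pure.2 hf).comp (preserves_pure.2 hg)) _
    (mem_possComp.2 ⟨f, rfl, g, rfl, rfl⟩)

theorem ProbModel.collapse_push {S T : Scenario.{u}} (p : PMF (DetProc S T)) (e : ProbModel S) :
    (e.push p).collapse = e.collapse.push (ClosedScen.collapse p) := by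
  refine PossModel.ext' fun σ => ?_
  change (p.bind fun f => (e.dist (f.imageCtx σ)).map (f.evMap σ)).support = _
  rw [PMF.support_bind]
  simp only [PMF.support_map]
  rfl

/-- Collapse commutes with push-forward, which gives one direction. For the other, the given `e`
collapses to the largest model satisfying the predicate, and testing that one is enough. -/
theorem preserves_collapse_iff (A B : GScenario.{u}) (hA : ∃ e : ProbModel A.scen, e.collapse = A.model)
    (p : PMF (DetProc A.scen B.scen)) :
    Preserves A B (collapse p) ↔
      ∀ e : ProbModel A.scen, e.Satisfies A.pred → (e.push p).Satisfies B.pred := by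
  constructor
  · intro h e he
    rw [ProbModel.Satisfies, ProbModel.collapse_push]
    exact h _ he
  · intro h
    obtain ⟨e, he⟩ := hA
    have h1 := h e (by rw [ProbModel.Satisfies, he]; exact A.model_satisfies)
    rw [ProbModel.Satisfies, ProbModel.collapse_push, he] at h1
    exact preserves_iff.2 (preserves_of_push_model h1)

/-! ### The structure maps preserve the structure predicates -/

theorem detPreserves_id (A : GScenario.{u}) : DetPreserves A A (DetProc.id A.scen) :=
  preserves_pure.1 (preserves_id A)

/-- Grouping a family over `π(σ)` by the elements of `σ` does not change the measurements of `P`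
that are read. The two unions agree only as sets, so both inclusions are needed. -/
theorem detPreserves_postcomp (P : GScenario.{u}) {A B : GScenario.{u}}
    {f : DetProc A.scen B.scen} (hf : DetPreserves A B f) :
    DetPreserves (homObj P A) (homObj P B) (f.postcomp P.scen) := by
  rintro (σ : B.scen.ctx) (k : (homScen P.scen A.scen).Ev (f.image σ)) ⟨hU, hk⟩
  have hle : outUnion ((f.postcomp P.scen).evMap σ.1 k) ⊆ outUnion k := by
    rintro y ⟨x, hx, z, hz, hy⟩
    exact ⟨z, ⟨x, hx, hz⟩, hy⟩
  have hge : outUnion k ⊆ outUnion ((f.postcomp P.scen).evMap σ.1 k) := by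
    rintro y ⟨z, ⟨x, hx, hz⟩, hy⟩
    exact ⟨x, hx, z, hz, hy⟩
  refine ⟨P.scen.down_closed hU hle, fun s hs => ?_⟩
  exact hf σ _ (hk _ (P.model.mem_restrict (τ := ⟨outUnion k, hU⟩) hge hs))

/-- A family reading `U` is turned into one reading `π(U)`, a context because `f` is simplicial;
preservation by `f` at `U` then feeds allowed outcomes to `k`. -/
theorem detPreserves_precomp {A B : GScenario.{u}} {f : DetProc A.scen B.scen}
    (hf : DetPreserves A B f) (P : GScenario.{u}) :
    DetPreserves (homObj B P) (homObj A P) (f.precomp P.scen) := by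
  rintro (σ : P.scen.ctx)
    (k : (homScen B.scen P.scen).Ev ((f.precomp P.scen).image σ.1)) ⟨hU, hk⟩
  have hle : outUnion ((f.precomp P.scen).evMap σ.1 k) ⊆ f.image (outUnion k) := by
    rintro y ⟨x, hx, z, hz, hy⟩
    exact ⟨z, ⟨x, ⟨x, hx, rfl⟩, hz⟩, hy⟩
  have hge : f.image (outUnion k) ⊆ outUnion ((f.precomp P.scen).evMap σ.1 k) := by
    rintro y ⟨z, ⟨x, ⟨x', hx, hx'⟩, hz⟩, hy⟩
    obtain rfl : x = x' := hx'
    exact ⟨x, hx, z, hz, hy⟩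
  have hc := f.simplicial _ hU
  refine ⟨A.scen.down_closed hc hle, fun s hs => ?_⟩
  have h1 := hk _ (hf ⟨outUnion k, hU⟩ _ (A.model.mem_restrict
    (σ := ⟨_, A.scen.down_closed hc hle⟩) (τ := ⟨_, hc⟩) hge hs))
  have hσ : (σ : Set P.scen.X) ⊆ (f.precomp P.scen).image σ.1 := fun x hx => ⟨x, hx, rfl⟩
  exact P.model.mem_of_agree hσ h1 fun _ _ => rfl

theorem detPreserves_homMap {A A' B B' : GScenario.{u}} {f : DetProc A'.scen A.scen}
    {g : DetProc B.scen B'.scen} (hf : DetPreserves A' A f) (hg : DetPreserves B B' g) :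
    DetPreserves (homObj A B) (homObj A' B') (DetProc.homMap f g) :=
  DetPreserves.comp (B := homObj A' B) (detPreserves_precomp hf B) (detPreserves_postcomp A' hg)

theorem detPreserves_iMap (A : GScenario.{u}) :
    DetPreserves A (homObj unit A) (DetProc.iMap A.scen) := by
  intro (σ : A.scen.ctx) s hs
  refine ⟨trivial, fun p _ => ?_⟩
  have hσ : (σ : Set A.scen.X) ⊆ (DetProc.iMap A.scen).image σ.1 := fun x hx => ⟨x, hx, rfl⟩
  exact A.model.mem_of_agree hσ hs fun _ _ => rfl

/-- The inverse of `iMap`. -/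
def DetProc.iInv (S : Scenario.{u}) : DetProc (homScen zero S) S where
  rel x := {x}
  simplicial := (id S).simplicial
  act x k := (k x rfl).2 fun y _ => y.elim

theorem detPreserves_iInv (A : GScenario.{u}) :
    DetPreserves (homObj unit A) A (DetProc.iInv A.scen) := by
  rintro σ k ⟨hU, hk⟩
  have h1 := hk (fun y _ => PEmpty.elim y) trivial
  have hσ : (σ : Set A.scen.X) ⊆ (DetProc.iInv A.scen).image σ.1 := fun x hx => ⟨x, hx, rfl⟩
  refine A.model.mem_of_agree hσ h1 fun y hy => ?_
  exact congrArg (k y _).2 (funext fun z => z.elim)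

theorem detPreserves_jMap (A : GScenario.{u}) :
    DetPreserves unit (homObj A A) (DetProc.jMap A.scen) := by
  intro (σ : A.scen.ctx) s hs
  have hle : outUnion ((DetProc.jMap A.scen).evMap σ.1 s) ⊆ σ.1 := by
    rintro y ⟨x, hx, hy⟩
    obtain rfl : y = x := hy
    exact hx
  have hge : (σ : Set A.scen.X) ⊆ outUnion ((DetProc.jMap A.scen).evMap σ.1 s) :=
    fun x hx => ⟨x, hx, rfl⟩
  refine ⟨A.scen.down_closed σ.2 hle, fun s hs => ?_⟩
  exact A.model.mem_of_agree hge hs fun _ _ => rfl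

/-- Composites of preserving families preserve: `m` sends outcomes allowed by `A` to ones allowed by
`B`, and `k` sends these to ones allowed by `D`. The composite reads exactly what `m` reads, as `m`
is indexed by the measurements that `k` reads. -/
theorem detPreserves_LMap (A B D : GScenario.{u}) :
    DetPreserves (homObj B D) (homObj (homObj A B) (homObj A D))
      (DetProc.LMap A.scen B.scen D.scen) := by
  rintro (σ : D.scen.ctx)
    (k : (homScen B.scen D.scen).Ev ((DetProc.LMap A.scen B.scen D.scen).image σ.1)) ⟨hU, hk⟩
  let k' : (homScen (homScen A.scen B.scen) (homScen A.scen D.scen)).Ev σ.1 :=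
    (DetProc.LMap A.scen B.scen D.scen).evMap σ.1 k
  have hle : outUnion k' ⊆ outUnion (S := B.scen) k := by
    rintro y ⟨x, hx, hy⟩
    exact ⟨x, ⟨x, hx, rfl⟩, hy⟩
  have hge : outUnion (S := B.scen) k ⊆ outUnion (S := homScen A.scen B.scen) k' := by
    rintro y ⟨x, ⟨x', hx, hx'⟩, hy⟩
    obtain rfl : x = x' := hx'
    exact ⟨x, hx, hy⟩
  refine ⟨B.scen.down_closed hU hle, ?_⟩
  rintro (m : (homScen A.scen B.scen).Ev (outUnion k')) ⟨hV, hm⟩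
  have hle' : outUnion (outApply k' m) ⊆ outUnion m := by
    rintro y ⟨x, hx, z, hz, hy⟩
    exact ⟨z, ⟨x, hx, hz⟩, hy⟩
  have hge' : outUnion m ⊆ outUnion (outApply k' m) := by
    rintro y ⟨z, ⟨x, hx, hz⟩, hy⟩
    exact ⟨x, hx, z, hz, hy⟩
  refine ⟨A.scen.down_closed hV hle', fun s hs => ?_⟩
  have h1 := hm _ (A.model.mem_restrict (τ := ⟨outUnion m, hV⟩) hge' hs)
  have h2 := hk _ (B.model.mem_restrict (τ := ⟨outUnion k, hU⟩) hge h1)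
  have hσ : (σ : Set D.scen.X) ⊆ (DetProc.LMap A.scen B.scen D.scen).image σ.1 :=
    fun x hx => ⟨x, hx, rfl⟩
  exact D.model.mem_of_agree hσ h2 fun _ _ => rfl

/-! ### Identities between deterministic procedures -/

namespace DetProc

variable {S T V P P' S' S'' T' T'' : Scenario.{u}}

/-- Comparing the functions on arguments that agree where both are defined replaces a heterogeneous
equality; `out_apply` is the converse. -/
theorem out_ext {x : T.X} {o o' : (homScen S T).O x} (h : o.1 = o'.1)
    (h' : ∀ (s : S.Ev o.1) (t : S.Ev o'.1), (∀ y hy hy', s y hy = t y hy') → o.2 s = o'.2 t) :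
    o = o' := by
  obtain ⟨U, k⟩ := o
  obtain ⟨V, l⟩ := o'
  obtain rfl : U = V := h
  exact congrArg (Sigma.mk U) (funext fun s => h' s s fun _ _ _ => rfl)

theorem out_apply {x : T.X} {o o' : (homScen S T).O x} (h : o = o') {s : S.Ev o.1}
    {t : S.Ev o'.1} (hst : ∀ y hy hy', s y hy = t y hy') : o.2 s = o'.2 t := by
  subst h
  exact congrArg o.2 (funext fun y => funext fun hy => hst y hy hy)

theorem mem_of_out_eq {x : T.X} {o o' : (homScen S T).O x} (h : o = o') {y : S.X}
    (hy : y ∈ o.1) : y ∈ o'.1 :=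
  h ▸ hy

theorem act_congr (f : DetProc S T) {x : T.X} {s t : S.Ev (f.rel x)}
    (h : ∀ y hy, s y hy = t y hy) : f.act x s = f.act x t :=
  congrArg (f.act x) (funext fun y => funext fun hy => h y hy)

/-! ### Bifunctoriality of the internal hom -/

theorem homMap_id (S T : Scenario.{u}) : homMap (id S) (id T) = id (homScen S T) := by
  refine ext' (fun x => ?_) (fun x s t h => ?_)
  · ext y
    exact ⟨fun ⟨z, hz, hy⟩ => hy.trans hz, fun hy => ⟨x, rfl, hy⟩⟩
  · refine out_ext ?_ fun p q hpq => ?_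
    · ext y
      constructor
      · rintro ⟨z, rfl, w, hw, rfl⟩
        exact mem_of_out_eq (h _ _ rfl) hw
      · intro hy
        exact ⟨x, rfl, y, mem_of_out_eq (h x ⟨x, rfl, rfl⟩ rfl).symm hy, rfl⟩
    · exact out_apply (h x ⟨x, rfl, rfl⟩ rfl) fun y _ _ => hpq _ _ _

theorem homMap_comp (f : DetProc S' S) (f' : DetProc S'' S') (g : DetProc T T')
    (g' : DetProc T' T'') :
    homMap (f'.comp f) (g.comp g') = (homMap f g).comp (homMap f' g') := by
  refine ext' (fun x => ?_) (fun x s t h => ?_)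
  · ext y
    constructor
    · rintro ⟨z, ⟨w, hw, hz⟩, rfl⟩
      exact ⟨w, ⟨w, hw, rfl⟩, y, hz, rfl⟩
    · rintro ⟨z, ⟨_, hw, rfl⟩, _, hy, rfl⟩
      exact ⟨y, ⟨z, hw, hy⟩, rfl⟩
  · refine out_ext ?_ fun p q hpq => ?_
    · ext y
      constructor
      · rintro ⟨z, ⟨w, hw, hz⟩, a, ha, b, hb, hy⟩
        refine ⟨w, hw, b, ⟨z, hz, a, mem_of_out_eq (h z ?_ ?_) ha, hb⟩, hy⟩
        exact ⟨z, ⟨w, hw, hz⟩, rfl⟩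
        exact ⟨w, ⟨w, hw, rfl⟩, z, hz, rfl⟩
      · rintro ⟨w, hw, b, ⟨z, hz, a, ha, hb⟩, hy⟩
        refine ⟨z, ⟨w, hw, hz⟩, a, mem_of_out_eq (h z ?_ ?_).symm ha, b, hb, hy⟩
        exact ⟨z, ⟨w, hw, hz⟩, rfl⟩
        exact ⟨w, ⟨w, hw, rfl⟩, z, hz, rfl⟩
    · refine act_congr _ fun w hw => act_congr _ fun z hz => ?_
      refine out_apply (h _ _ _) fun a _ _ => act_congr _ fun b hb => act_congr _ fun y hy => ?_
      exact hpq _ _ _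

/-! ### Naturality of `i` and its inverse, dinaturality of `j` -/

theorem iMap_natural (f : DetProc S T) :
    f.comp (iMap T) = (iMap S).comp (homMap (id zero) f) := by
  refine ext' (fun x => ?_) (fun x s t h => ?_)
  · ext y
    constructor
    · rintro ⟨_, rfl, hy⟩
      exact ⟨y, ⟨y, hy, rfl⟩, rfl⟩
    · rintro ⟨_, ⟨z, hz, rfl⟩, rfl⟩
      exact ⟨x, rfl, hz⟩
  · refine out_ext ?_ fun p q hpq => ?_
    · ext y
      exact y.elim
    · exact act_congr _ fun y hy => h _ _ _

theorem iMap_iInv (S : Scenario.{u}) : (iMap S).comp (iInv S) = id S := by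
  refine ext' (fun x => ?_) (fun x s t h => ?_)
  · ext y
    exact ⟨fun ⟨z, hz, hy⟩ => hy.trans hz, fun hy => ⟨x, rfl, hy⟩⟩
  · exact h _ _ _

theorem iInv_iMap (S : Scenario.{u}) : (iInv S).comp (iMap S) = id (homScen zero S) := by
  refine ext' (fun x => ?_) (fun x s t h => ?_)
  · ext y
    exact ⟨fun ⟨z, hz, hy⟩ => hy.trans hz, fun hy => ⟨x, rfl, hy⟩⟩
  · refine out_ext ?_ fun p q hpq => ?_
    · ext y
      exact y.elim
    · exact out_apply (h x ⟨x, rfl, rfl⟩ rfl) fun y _ _ => y.elim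

theorem jMap_dinatural (f : DetProc S T) :
    (jMap S).comp (homMap (id S) f) = (jMap T).comp (homMap f (id T)) := by
  refine ext' (fun x => ?_) (fun x s t h => ?_)
  · ext y
    exact y.elim
  · refine out_ext ?_ fun p q hpq => ?_
    · ext y
      constructor
      · rintro ⟨z, hz, w, hw, hy⟩
        obtain rfl : y = z := Eq.trans hy hw
        exact ⟨x, rfl, x, rfl, hz⟩
      · rintro ⟨z, hz, w, hw, hy⟩
        obtain rfl : w = x := Eq.trans hw hz
        exact ⟨y, hy, y, rfl, rfl⟩
    · exact act_congr _ fun y hy => hpq _ _ _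

/-! ### Naturality and dinaturality of `L`: both sides are the composite `m ; f ; k ; g`,
respectively `f ; m ; k` -/

theorem LMap_natural (P : Scenario.{u}) (f : DetProc T' T) (g : DetProc V S) :
    (LMap P T V).comp (homMap (homMap (id P) f) (homMap (id P) g)) =
      (homMap f g).comp (LMap P T' S) := by
  refine ext' (fun x => ?_) (fun x s t h => ?_)
  · ext y
    constructor
    · rintro ⟨_, ⟨_, ⟨z, hz, rfl⟩, rfl⟩, rfl⟩
      exact ⟨x, rfl, y, hz, rfl⟩
    · rintro ⟨_, rfl, z, hz, rfl⟩
      exact ⟨y, ⟨y, ⟨y, hz, rfl⟩, rfl⟩, rfl⟩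
  · have h' := fun y (hy : y ∈ g.rel x) =>
      h y ⟨y, ⟨y, ⟨y, hy, rfl⟩, rfl⟩, rfl⟩ ⟨x, rfl, y, hy, rfl⟩
    refine out_ext ?_ fun p q hpq => out_ext ?_ fun a b hab => ?_
    · ext y
      constructor
      · rintro ⟨z, ⟨c, hc, hz⟩, a, ha, b, hb, hy⟩
        obtain rfl : z = c := hz
        obtain rfl : y = b := hy
        exact ⟨z, hc, a, mem_of_out_eq (h' _ hc) ha, hb⟩
      · rintro ⟨z, hz, a, ha, hy⟩
        exact ⟨z, ⟨z, hz, rfl⟩, a, mem_of_out_eq (h' _ hz).symm ha, y, hy, rfl⟩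
    · ext y
      constructor
      · rintro ⟨z, hz, b, ⟨a, ha, c, hc, b', hb', hb⟩, hy⟩
        obtain rfl : b = b' := hb
        obtain rfl : y = b := hy
        have ha' := mem_of_out_eq (h' _ hz) ha
        exact ⟨c, ⟨z, hz, a, ha', hc⟩, mem_of_out_eq (hpq c
          ⟨z, ⟨z, hz, rfl⟩, a, ha, c, hc, rfl⟩ ⟨z, hz, a, ha', hc⟩) hb'⟩
      · rintro ⟨c, ⟨z, hz, a, ha, hc⟩, hy⟩
        have ha' := mem_of_out_eq (h' _ hz).symm ha
        exact ⟨z, hz, y, ⟨a, ha', c, hc, y, mem_of_out_eq (hpq c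
          ⟨z, ⟨z, hz, rfl⟩, a, ha', c, hc, rfl⟩ ⟨z, hz, a, ha, hc⟩).symm hy, rfl⟩, rfl⟩
    · refine act_congr _ fun y hy => ?_
      refine out_apply (h' _ hy) fun z hz hz' => act_congr _ fun w hw => ?_
      refine out_apply (hpq _ _ _) fun v hv hv' => ?_
      exact hab _ _ _

theorem LMap_dinatural (f : DetProc P P') (T V : Scenario.{u}) :
    (LMap P' T V).comp (homMap (id (homScen P' T)) (homMap f (id V))) =
      (LMap P T V).comp (homMap (homMap f (id T)) (id (homScen P V))) := by
  refine ext' (fun x => ?_) (fun x s t h => ?_)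
  · ext y
    constructor
    · rintro ⟨_, ⟨_, ⟨_, rfl, rfl⟩, rfl⟩, rfl⟩
      exact ⟨y, ⟨y, rfl, rfl⟩, rfl⟩
    · rintro ⟨_, ⟨_, rfl, rfl⟩, rfl⟩
      exact ⟨y, ⟨y, ⟨y, rfl, rfl⟩, rfl⟩, rfl⟩
  · have h' := h x ⟨x, ⟨x, ⟨x, rfl, rfl⟩, rfl⟩, rfl⟩ ⟨x, ⟨x, rfl, rfl⟩, rfl⟩
    refine out_ext ?_ fun p q hpq => out_ext ?_ fun a b hab => ?_
    · ext y
      constructor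
      · rintro ⟨z, ⟨c, hc, hz⟩, a, ha, hy⟩
        obtain rfl : z = x := Eq.trans hz hc
        exact ⟨z, rfl, a, mem_of_out_eq h' ha, a, rfl, hy⟩
      · rintro ⟨z, hz, a, ha, c, hc, hy⟩
        obtain rfl : z = x := hz
        exact ⟨z, ⟨z, rfl, rfl⟩, a, mem_of_out_eq h'.symm ha, Eq.trans hy hc⟩
    · ext y
      constructor
      · rintro ⟨z, hz, b, ⟨a, ha, hb⟩, hy⟩
        obtain rfl : z = x := hz
        have ha' := mem_of_out_eq h' ha
        exact ⟨a, ha', a, rfl, b, mem_of_out_eq (hpq a ⟨z, ⟨z, rfl, rfl⟩, a, ha, rfl⟩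
          ⟨z, rfl, a, ha', a, rfl, rfl⟩) hb, hy⟩
      · rintro ⟨a, ha, c, hc, b, hb, hy⟩
        obtain rfl : c = a := hc
        have ha' := mem_of_out_eq h'.symm ha
        exact ⟨x, rfl, b, ⟨c, ha', mem_of_out_eq (hpq c ⟨x, ⟨x, rfl, rfl⟩, c, ha', rfl⟩
          ⟨x, rfl, c, ha, c, rfl, rfl⟩).symm hb⟩, hy⟩
    · refine out_apply h' fun z hz hz' => ?_
      refine out_apply (hpq _ _ _) fun v hv hv' => act_congr _ fun w hw => ?_
      exact hab _ _ _

/-! ### The coherence axioms CC1 to CC4: unit laws, associativity, and points as outcomes -/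

theorem jMap_LMap (P T : Scenario.{u}) : (jMap T).comp (LMap P T T) = jMap (homScen P T) := by
  refine ext' (fun x => ?_) (fun x s t h => ?_)
  · ext y
    exact y.elim
  · refine out_ext rfl fun p q hpq => out_ext ?_ fun a b hab => ?_
    · ext y
      constructor
      · rintro ⟨z, hz, hy⟩
        obtain rfl : z = x := hz
        exact mem_of_out_eq (hpq z rfl rfl) hy
      · intro hy
        exact ⟨x, rfl, mem_of_out_eq (hpq x rfl rfl).symm hy⟩
    · exact out_apply (hpq x rfl rfl) fun y _ _ => hab _ _ _

theorem LMap_jMap (P T : Scenario.{u}) :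
    (LMap P P T).comp (homMap (jMap P) (id (homScen P T))) = iMap (homScen P T) := by
  refine ext' (fun x => ?_) (fun x s t h => ?_)
  · ext y
    constructor
    · rintro ⟨_, ⟨_, rfl, rfl⟩, rfl⟩
      rfl
    · rintro rfl
      exact ⟨y, ⟨y, rfl, rfl⟩, rfl⟩
  · have h' := h x ⟨x, ⟨x, rfl, rfl⟩, rfl⟩ rfl
    refine out_ext ?_ fun p q hpq => out_ext ?_ fun a b hab => ?_
    · ext y
      exact y.elim
    · ext y
      constructor
      · rintro ⟨a, ha, hy⟩
        obtain rfl : y = a := hy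
        exact mem_of_out_eq h' ha
      · intro hy
        exact ⟨y, mem_of_out_eq h'.symm hy, rfl⟩
    · exact out_apply h' fun y _ _ => hab _ _ _

/-- Associativity of internal composition: both sides send `k`, `p`, `a` to `a ; p ; k`. Each of the
three nested functions costs one use of `out_ext`. -/
theorem LMap_LMap (P S T V : Scenario.{u}) :
    (LMap P T V).comp ((LMap (homScen P S) (homScen P T) (homScen P V)).comp
        (homMap (LMap P S T) (id (homScen (homScen P S) (homScen P V))))) =
      (LMap S T V).comp (homMap (id (homScen S T)) (LMap P S V)) := by
  refine ext' (fun x => ?_) (fun x s t h => ?_)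
  · ext y
    constructor
    · rintro ⟨_, ⟨_, ⟨_, rfl, rfl⟩, rfl⟩, rfl⟩
      exact ⟨y, ⟨y, rfl, rfl⟩, rfl⟩
    · rintro ⟨_, ⟨_, rfl, rfl⟩, rfl⟩
      exact ⟨y, ⟨y, ⟨y, rfl, rfl⟩, rfl⟩, rfl⟩
  · have h' := h x ⟨x, ⟨x, ⟨x, rfl, rfl⟩, rfl⟩, rfl⟩ ⟨x, ⟨x, rfl, rfl⟩, rfl⟩
    refine out_ext ?_ fun p q hpq => ?_
    · ext y
      constructor
      · rintro ⟨z, hz, a, ha, hy⟩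
        obtain rfl : z = x := hz
        exact ⟨z, rfl, a, mem_of_out_eq h' ha, hy⟩
      · rintro ⟨z, hz, a, ha, hy⟩
        obtain rfl : z = x := hz
        exact ⟨z, rfl, a, mem_of_out_eq h'.symm ha, hy⟩
    have hp := fun a ha ha' => hpq a ⟨x, rfl, a, ha, rfl⟩ ⟨x, rfl, a, ha', rfl⟩
    refine out_ext ?_ fun a b hab => out_ext ?_ fun c d hcd => ?_
    · ext y
      constructor
      · rintro ⟨a, ha, hy⟩
        have ha' := mem_of_out_eq h' ha
        exact ⟨a, ha', mem_of_out_eq (hp a ha ha') hy⟩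
      · rintro ⟨a, ha, hy⟩
        have ha' := mem_of_out_eq h'.symm ha
        exact ⟨a, ha', mem_of_out_eq (hp a ha' ha).symm hy⟩
    · ext y
      constructor
      · rintro ⟨c, hc, v, hv, hy⟩
        have hc' := mem_of_out_eq h' hc
        have hv' := mem_of_out_eq (hp c hc hc') hv
        exact ⟨v, ⟨c, hc', hv'⟩, mem_of_out_eq (hab v ⟨c, hc, hv⟩ ⟨c, hc', hv'⟩) hy⟩
      · rintro ⟨v, ⟨c, hc, hv⟩, hy⟩
        have hc' := mem_of_out_eq h'.symm hc
        have hv' := mem_of_out_eq (hp c hc' hc).symm hv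
        exact ⟨c, hc', v, hv', mem_of_out_eq (hab v ⟨c, hc', hv'⟩ ⟨c, hc, hv⟩).symm hy⟩
    · refine out_apply h' fun w hw hw' => out_apply (hp w hw hw') fun v hv hv' => ?_
      exact out_apply (hab _ _ _) fun y _ _ => hcd _ _ _

theorem LMap_iMap (S T : Scenario.{u}) :
    (LMap zero S T).comp (homMap (iMap S) (id (homScen zero T))) = homMap (id S) (iMap T) := by
  refine ext' (fun x => ?_) (fun x s t h => ?_)
  · ext y
    constructor
    · rintro ⟨_, ⟨_, rfl, rfl⟩, rfl⟩
      exact ⟨y, rfl, rfl⟩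
    · rintro ⟨_, rfl, rfl⟩
      exact ⟨y, ⟨y, rfl, rfl⟩, rfl⟩
  · have h' := h x ⟨x, ⟨x, rfl, rfl⟩, rfl⟩ ⟨x, rfl, rfl⟩
    refine out_ext ?_ fun p q hpq => out_ext ?_ fun a b hab => ?_
    · ext y
      constructor
      · rintro ⟨z, hz, a, ha, hy⟩
        obtain rfl : z = x := hz
        exact ⟨z, rfl, a, mem_of_out_eq h' ha, hy⟩
      · rintro ⟨z, hz, a, ha, hy⟩
        obtain rfl : z = x := hz
        exact ⟨z, rfl, a, mem_of_out_eq h'.symm ha, hy⟩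
    · ext y
      exact y.elim
    · exact out_apply h' fun y _ _ => hpq _ _ _

/-- The procedure `0 → [S, T]` that picks the function and the measurements of `f : S → T`. -/
def name (f : DetProc S T) : DetProc zero (homScen S T) where
  rel _ := ∅
  simplicial _ _ := trivial
  act x _ := ⟨f.rel x, f.act x⟩

theorem jMap_homMap (f : DetProc S T) : (jMap S).comp (homMap (id S) f) = f.name := by
  refine ext' (fun x => ?_) (fun x s t h => ?_)
  · ext y
    exact y.elim
  · refine out_ext ?_ fun p q hpq => ?_
    · ext y
      constructor
      · rintro ⟨z, hz, w, hw, hy⟩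
        obtain rfl : y = z := Eq.trans hy hw
        exact hz
      · intro hy
        exact ⟨y, hy, y, rfl, rfl⟩
    · exact act_congr _ fun y hy => hpq _ _ _

theorem name_injective : Function.Injective (name (S := S) (T := T)) := by
  intro f g h
  have h' : ∀ x, (⟨f.rel x, f.act x⟩ : (homScen S T).O x) = ⟨g.rel x, g.act x⟩ := by
    intro x
    -- All names have the relation `∅`, so the type of `act` does not depend on the procedure and
    -- the heterogeneous equality is an actual one.
    have h1 : HEq f.name.act g.name.act := by rw [h]
    exact congrFun (congrFun (eq_of_heq h1) x) fun y _ => y.elim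
  exact ext' (fun x => congrArg Sigma.fst (h' x)) fun x s t hst => out_apply (h' x) hst

end DetProc

open DetProc

/-! ### The points of the internal hom -/

/-- Every point of `[A, B]` that preserves the structure predicates is the name of a deterministic
procedure that preserves them. -/
theorem exists_name {A B : GScenario.{u}} {q : DetProc zero (homScen A.scen B.scen)}
    (hq : DetPreserves unit (homObj A B) q) :
    ∃ f : DetProc A.scen B.scen, f.name = q ∧ DetPreserves A B f := by
  -- There is just one assignment on a set of measurements of the empty scenario, so `q` amounts to
  -- a fixed outcome at each `x`.
  let k : ∀ x, (homScen A.scen B.scen).O x := fun x => q.act x fun y _ => y.elim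
  have hk : ∀ x s, q.act x s = k x := fun x s => congrArg (q.act x) (funext fun y => y.elim)
  -- The two clauses of the hom predicate become the simplicial condition for `x ↦ (k x).1` and the
  -- preservation of the predicates.
  have hq' : ∀ σ : B.scen.ctx, ∃ hU : {y | ∃ x ∈ σ.1, y ∈ (k x).1} ∈ A.scen.ctx,
      ∀ s ∈ A.model.supp ⟨_, hU⟩,
        (fun x hx => (k x).2 fun y hy => s y ⟨x, hx, hy⟩ : B.scen.Ev σ) ∈ B.model.supp σ := by
    intro σ
    obtain ⟨hU, h⟩ := hq σ (fun y _ => PEmpty.elim y) trivial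
    have hle : {y | ∃ x ∈ σ.1, y ∈ (k x).1} ⊆ outUnion (S := A.scen) (T := B.scen)
        (q.evMap σ.1 fun y _ => PEmpty.elim y) := by
      rintro y ⟨x, hx, hy⟩
      exact ⟨x, hx, mem_of_out_eq (hk x _).symm hy⟩
    have hge : outUnion (S := A.scen) (T := B.scen) (q.evMap σ.1 fun y _ => PEmpty.elim y) ⊆
        {y | ∃ x ∈ σ.1, y ∈ (k x).1} := by
      rintro y ⟨x, hx, hy⟩
      exact ⟨x, hx, mem_of_out_eq (hk x _) hy⟩
    refine ⟨A.scen.down_closed hU hle, fun s hs => ?_⟩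
    have h1 := h _ (A.model.mem_restrict (σ := ⟨_, A.scen.down_closed hU hle⟩)
      (τ := ⟨_, hU⟩) hge hs)
    refine B.model.mem_of_agree subset_rfl h1 fun x hx => ?_
    exact out_apply (hk x _).symm fun _ _ _ => rfl
  refine ⟨⟨fun x => (k x).1, fun σ hσ => (hq' ⟨σ, hσ⟩).1, fun x => (k x).2⟩, ?_,
    fun σ s hs => (hq' σ).2 s hs⟩
  refine ext' (fun x => ?_) fun x s t _ => (hk x t).symm
  ext y
  exact y.elim

theorem detPreserves_of_name {A B : GScenario.{u}} {f : DetProc A.scen B.scen}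
    (hf : DetPreserves unit (homObj A B) f.name) : DetPreserves A B f := by
  obtain ⟨g, hg, h⟩ := exists_name hf
  rwa [← name_injective hg]

/-! ### The probabilistic case -/

theorem preserves_probComp {A B D : GScenario.{u}} {p : PMF (DetProc A.scen B.scen)}
    {q : PMF (DetProc B.scen D.scen)} (hp : Preserves A B (collapse p))
    (hq : Preserves B D (collapse q)) : Preserves A D (collapse (probComp p q)) := by
  rw [collapse_probComp]
  exact hp.comp hq

theorem pmf_bind_congr {α β : Type u} (p : PMF α) {G H : α → PMF β}
    (h : ∀ a ∈ p.support, G a = H a) : p.bind G = p.bind H := by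
  refine PMF.ext fun b => ?_
  rw [PMF.bind_apply, PMF.bind_apply]
  refine tsum_congr fun a => ?_
  by_cases ha : a ∈ p.support
  · rw [h a ha]
  · rw [(PMF.apply_eq_zero_iff _ _).2 ha, zero_mul, zero_mul]

/-- Pushing forward along a left inverse of `n` recovers the distribution. -/
theorem pmf_bind_pure_injective {α β : Type u} {n : α → β} (hn : Function.Injective n) :
    Function.Injective fun p : PMF α => p.bind fun a => PMF.pure (n a) := by
  intro p q h
  obtain ⟨a₀, _⟩ := p.support_nonempty
  have : Nonempty α := ⟨a₀⟩
  have h1 := congrArg (fun r : PMF β => r.bind fun b => PMF.pure (Function.invFun n b)) h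
  simpa [PMF.bind_bind, PMF.pure_bind, Function.leftInverse_invFun hn _, PMF.bind_pure] using h1

/-! ### Convex extension of the deterministic identities -/

section probabilistic

variable {S S' S'' T T' T'' P P' V : Scenario.{u}}

/-- The convex bilinear extension of `DetProc.homMap`. -/
noncomputable def probHomMap (p : PMF (DetProc S' S)) (q : PMF (DetProc T T')) :
    PMF (DetProc (homScen S T) (homScen S' T')) :=
  p.bind fun f => q.bind fun g => PMF.pure (homMap f g)

theorem probHomMap_id (S T : Scenario.{u}) :
    probHomMap (PMF.pure (DetProc.id S)) (PMF.pure (DetProc.id T)) = PMF.pure (DetProc.id (homScen S T)) := by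
  simp only [probHomMap, PMF.pure_bind, homMap_id]

/-- The two sides draw the same four independent procedures in different orders, so commutativity of
the monad is needed here in addition to its unit and associativity laws. -/
theorem probHomMap_comp (p : PMF (DetProc S' S)) (p' : PMF (DetProc S'' S'))
    (q : PMF (DetProc T T')) (q' : PMF (DetProc T' T'')) :
    probHomMap (probComp p' p) (probComp q q') = probComp (probHomMap p q) (probHomMap p' q') := by
  simp only [probHomMap, probComp, PMF.bind_bind, PMF.pure_bind, homMap_comp]
  rw [PMF.bind_comm]
  congr 1
  funext f
  rw [PMF.bind_comm]

theorem probComp_pure_pure (f : DetProc S T) (g : DetProc T V) :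
    probComp (PMF.pure f) (PMF.pure g) = PMF.pure (f.comp g) := by
  simp only [probComp, PMF.pure_bind]

theorem probHomMap_pure_pure (f : DetProc S' S) (g : DetProc T T') :
    probHomMap (PMF.pure f) (PMF.pure g) = PMF.pure (homMap f g) := by
  simp only [probHomMap, PMF.pure_bind]

theorem probComp_iMap (p : PMF (DetProc S T)) :
    probComp p (PMF.pure (iMap T)) =
      probComp (PMF.pure (iMap S)) (probHomMap (PMF.pure (DetProc.id zero)) p) := by
  simp only [probHomMap, probComp, PMF.bind_bind, PMF.pure_bind, iMap_natural]

theorem jMap_probComp_dinatural (p : PMF (DetProc S T)) :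
    probComp (PMF.pure (jMap S)) (probHomMap (PMF.pure (DetProc.id S)) p) =
      probComp (PMF.pure (jMap T)) (probHomMap p (PMF.pure (DetProc.id T))) := by
  simp only [probHomMap, probComp, PMF.bind_bind, PMF.pure_bind, jMap_dinatural]

theorem jMap_probComp (p : PMF (DetProc S T)) :
    probComp (PMF.pure (jMap S)) (probHomMap (PMF.pure (DetProc.id S)) p) =
      p.bind fun f => PMF.pure f.name := by
  simp only [probHomMap, probComp, PMF.bind_bind, PMF.pure_bind, jMap_homMap]

theorem LMap_probComp_natural (P : Scenario.{u}) (p : PMF (DetProc T' T)) (q : PMF (DetProc V S)) :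
    probComp (PMF.pure (LMap P T V))
        (probHomMap (probHomMap (PMF.pure (DetProc.id P)) p) (probHomMap (PMF.pure (DetProc.id P)) q)) =
      probComp (probHomMap p q) (PMF.pure (LMap P T' S)) := by
  simp only [probHomMap, probComp, PMF.bind_bind, PMF.pure_bind, LMap_natural]

theorem LMap_probComp_dinatural (p : PMF (DetProc P P')) (T V : Scenario.{u}) :
    probComp (PMF.pure (LMap P' T V))
        (probHomMap (PMF.pure (DetProc.id (homScen P' T))) (probHomMap p (PMF.pure (DetProc.id V)))) =
      probComp (PMF.pure (LMap P T V))
        (probHomMap (probHomMap p (PMF.pure (DetProc.id T))) (PMF.pure (DetProc.id (homScen P V)))) := by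
  simp only [probHomMap, probComp, PMF.bind_bind, PMF.pure_bind, LMap_dinatural]

end probabilistic

/-! ### The closed structure on probabilistic procedures -/

namespace ProbHom

variable {A B A' B' : GScenario.{u}}

/-- A deterministic procedure that preserves the structure predicates, as a morphism. -/
noncomputable def ofDet (f : DetProc A.scen B.scen) (hf : DetPreserves A B f) : ProbHom A B :=
  ⟨PMF.pure f, by rw [collapse_pure]; exact preserves_pure.2 hf⟩

/-- The action of the internal hom on morphisms. -/
noncomputable def map (f : ProbHom A' A) (g : ProbHom B B') : ProbHom (homObj A B) (homObj A' B') where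
  proc := probHomMap f.proc g.proc
  preserves := preserves_iff.2 fun k hk => by
    obtain ⟨a, ha, hk⟩ := (PMF.mem_support_bind_iff _ _ _).1 hk
    obtain ⟨b, hb, hk⟩ := (PMF.mem_support_bind_iff _ _ _).1 hk
    obtain rfl := (PMF.mem_support_pure_iff _ _).1 hk
    exact detPreserves_homMap (preserves_iff.1 f.preserves a ha) (preserves_iff.1 g.preserves b hb)

/-- The point `j_A ; [1, f]` of the internal hom. -/
noncomputable def point (f : ProbHom A B) : ProbHom unit (homObj A B) where
  proc := probComp (PMF.pure (jMap A.scen)) (probHomMap (PMF.pure (DetProc.id A.scen)) f.proc)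
  preserves := preserves_probComp (A := unit) (B := homObj A A) (D := homObj A B)
    (ofDet (A := unit) (B := homObj A A) (jMap A.scen) (detPreserves_jMap A)).preserves
    (map (ofDet (A := A) (B := A) (DetProc.id A.scen) (detPreserves_id A)) f).preserves

/-- `point` is the push-forward along the injective map `name`, and each procedure in the support of
a point of `[A, B]` is a name. -/
theorem point_bijective (A B : GScenario.{u}) :
    Function.Bijective (point : ProbHom A B → ProbHom unit (homObj A B)) := by
  have key : ∀ f : ProbHom A B, f.point.proc = f.proc.bind fun a => PMF.pure a.name :=
    fun f => jMap_probComp f.proc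
  constructor
  · intro f g h
    have h1 := (key f).symm.trans ((congrArg ProbHom.proc h).trans (key g))
    exact ProbHom.ext (pmf_bind_pure_injective name_injective h1)
  · intro q
    have hq := fun a ha => exists_name (preserves_iff.1 q.preserves a ha)
    obtain ⟨a₀, ha₀⟩ := q.proc.support_nonempty
    have : Nonempty (DetProc A.scen B.scen) := ⟨(hq a₀ ha₀).choose⟩
    have hinv : ∀ a ∈ q.proc.support, name (Function.invFun name a) = a := by
      intro a ha
      obtain ⟨f, hf, _⟩ := hq a ha
      exact Function.invFun_eq ⟨f, hf⟩
    refine ⟨⟨q.proc.bind fun a => PMF.pure (Function.invFun name a),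
      preserves_iff.2 fun f hf => ?_⟩, ProbHom.ext ((key _).trans ?_)⟩
    · obtain ⟨a, ha, hf⟩ := (PMF.mem_support_bind_iff _ _ _).1 hf
      obtain rfl := (PMF.mem_support_pure_iff _ _).1 hf
      refine detPreserves_of_name ?_
      rw [hinv a ha]
      exact preserves_iff.1 q.preserves a ha
    · refine (PMF.bind_bind _ _ _).trans (Eq.trans ?_ (PMF.bind_pure q.proc))
      exact pmf_bind_congr _ fun a ha => (PMF.pure_bind _ _).trans (congrArg PMF.pure (hinv a ha))

/-- The closed structure on scenarios and probabilistic procedures. -/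
noncomputable def closedStructure : ClosedStructure ScenProb.{u} unit homObj where
  map f g := map f g
  map_id _ _ := ProbHom.ext (probHomMap_id _ _)
  map_comp f f' g g' := ProbHom.ext (probHomMap_comp f.proc f'.proc g.proc g'.proc)
  i A :=
    { hom := ofDet (iMap _) (detPreserves_iMap A)
      inv := ofDet (iInv _) (detPreserves_iInv A)
      hom_inv_id := ProbHom.ext <|
        (probComp_pure_pure _ _).trans (congrArg PMF.pure (iMap_iInv _))
      inv_hom_id := ProbHom.ext <|
        (probComp_pure_pure _ _).trans (congrArg PMF.pure (iInv_iMap _)) }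
  i_natural f := ProbHom.ext (probComp_iMap f.proc)
  j A := ofDet (jMap _) (detPreserves_jMap A)
  j_dinatural f := ProbHom.ext (jMap_probComp_dinatural f.proc)
  L A B D := ofDet (LMap _ _ _) (detPreserves_LMap A B D)
  L_natural A _ _ _ _ f g := ProbHom.ext (LMap_probComp_natural (GScenario.scen A) f.proc g.proc)
  L_dinatural f B D :=
    ProbHom.ext (LMap_probComp_dinatural f.proc (GScenario.scen B) (GScenario.scen D))
  -- CC1 to CC4 involve only point masses, so each is the image under `PMF.pure` of a deterministic
  -- identity.
  CC1 _ _ := ProbHom.ext <| (probComp_pure_pure _ _).trans (congrArg PMF.pure (jMap_LMap _ _))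
  CC2 _ _ := ProbHom.ext <| (congrArg (probComp _) (probHomMap_pure_pure _ _)).trans <|
    (probComp_pure_pure _ _).trans (congrArg PMF.pure (LMap_jMap _ _))
  CC3 _ _ _ _ := ProbHom.ext <|
    (congrArg (probComp _) ((congrArg (probComp _) (probHomMap_pure_pure _ _)).trans
      (probComp_pure_pure _ _))).trans <|
    (probComp_pure_pure _ _).trans <| (congrArg PMF.pure (LMap_LMap _ _ _ _)).trans <|
    ((congrArg (probComp _) (probHomMap_pure_pure _ _)).trans (probComp_pure_pure _ _)).symm
  CC4 _ _ := ProbHom.ext <| (congrArg (probComp _) (probHomMap_pure_pure _ _)).trans <|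
    (probComp_pure_pure _ _).trans <| (congrArg PMF.pure (LMap_iMap _ _)).trans
    (probHomMap_pure_pure _ _).symm
  CC5 := point_bijective

end ProbHom

/-! ### Boolean distributions -/

namespace BoolDist

variable {α β γ : Type u}

theorem mem_bind {F : BoolDist α} {G : α → BoolDist β} {b : β} :
    b ∈ (F.bind G).1 ↔ ∃ a ∈ F.1, b ∈ (G a).1 := by
  simp [bind]

theorem pure_bind (a : α) (G : α → BoolDist β) : (pure a).bind G = G a := by
  refine Subtype.ext (Set.ext fun b => ?_)
  simp [mem_bind, pure]

theorem bind_bind (F : BoolDist α) (G : α → BoolDist β) (K : β → BoolDist γ) :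
    (F.bind G).bind K = F.bind fun a => (G a).bind K := by
  refine Subtype.ext (Set.ext fun c => ?_)
  simp only [mem_bind]
  exact ⟨fun ⟨b, ⟨a, ha, hb⟩, hc⟩ => ⟨a, ha, b, hb, hc⟩,
    fun ⟨a, ha, b, hb, hc⟩ => ⟨b, ⟨a, ha, hb⟩, hc⟩⟩

theorem bind_comm (F : BoolDist α) (G : BoolDist β) (K : α → β → BoolDist γ) :
    (F.bind fun a => G.bind (K a)) = G.bind fun b => F.bind fun a => K a b := by
  refine Subtype.ext (Set.ext fun c => ?_)
  simp only [mem_bind]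
  exact ⟨fun ⟨a, ha, b, hb, hc⟩ => ⟨b, hb, a, ha, hc⟩,
    fun ⟨b, hb, a, ha, hc⟩ => ⟨a, ha, b, hb, hc⟩⟩

end BoolDist

/-! ### The possibilistic case -/

section possibilistic

variable {S S' S'' T T' T'' P P' V : Scenario.{u}}

/-- The Boolean bilinear extension of `DetProc.homMap`. -/
def possHomMap (p : BoolDist (DetProc S' S)) (q : BoolDist (DetProc T T')) :
    BoolDist (DetProc (homScen S T) (homScen S' T')) :=
  p.bind fun f => q.bind fun g => BoolDist.pure (homMap f g)

theorem possHomMap_id (S T : Scenario.{u}) :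
    possHomMap (BoolDist.pure (DetProc.id S)) (BoolDist.pure (DetProc.id T)) = BoolDist.pure (DetProc.id (homScen S T)) := by
  simp only [possHomMap, BoolDist.pure_bind, homMap_id]

/-- As in the probabilistic case, reordering the four independent choices uses `BoolDist.bind_comm`.
-/
theorem possHomMap_comp (p : BoolDist (DetProc S' S)) (p' : BoolDist (DetProc S'' S'))
    (q : BoolDist (DetProc T T')) (q' : BoolDist (DetProc T' T'')) :
    possHomMap (possComp p' p) (possComp q q') = possComp (possHomMap p q) (possHomMap p' q') := by
  simp only [possHomMap, possComp, BoolDist.bind_bind, BoolDist.pure_bind, homMap_comp]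
  rw [BoolDist.bind_comm]
  congr 1
  funext f
  rw [BoolDist.bind_comm]

theorem possComp_pure_pure (f : DetProc S T) (g : DetProc T V) :
    possComp (BoolDist.pure f) (BoolDist.pure g) = BoolDist.pure (f.comp g) := by
  simp only [possComp, BoolDist.pure_bind]

theorem possHomMap_pure_pure (f : DetProc S' S) (g : DetProc T T') :
    possHomMap (BoolDist.pure f) (BoolDist.pure g) = BoolDist.pure (homMap f g) := by
  simp only [possHomMap, BoolDist.pure_bind]

theorem possComp_iMap (p : BoolDist (DetProc S T)) :
    possComp p (BoolDist.pure (iMap T)) =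
      possComp (BoolDist.pure (iMap S)) (possHomMap (BoolDist.pure (DetProc.id zero)) p) := by
  simp only [possHomMap, possComp, BoolDist.bind_bind, BoolDist.pure_bind, iMap_natural]

theorem jMap_possComp_dinatural (p : BoolDist (DetProc S T)) :
    possComp (BoolDist.pure (jMap S)) (possHomMap (BoolDist.pure (DetProc.id S)) p) =
      possComp (BoolDist.pure (jMap T)) (possHomMap p (BoolDist.pure (DetProc.id T))) := by
  simp only [possHomMap, possComp, BoolDist.bind_bind, BoolDist.pure_bind, jMap_dinatural]

theorem jMap_possComp (p : BoolDist (DetProc S T)) :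
    possComp (BoolDist.pure (jMap S)) (possHomMap (BoolDist.pure (DetProc.id S)) p) =
      p.bind fun f => BoolDist.pure f.name := by
  simp only [possHomMap, possComp, BoolDist.bind_bind, BoolDist.pure_bind, jMap_homMap]

theorem LMap_possComp_natural (P : Scenario.{u}) (p : BoolDist (DetProc T' T)) (q : BoolDist (DetProc V S)) :
    possComp (BoolDist.pure (LMap P T V))
        (possHomMap (possHomMap (BoolDist.pure (DetProc.id P)) p) (possHomMap (BoolDist.pure (DetProc.id P)) q)) =
      possComp (possHomMap p q) (BoolDist.pure (LMap P T' S)) := by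
  simp only [possHomMap, possComp, BoolDist.bind_bind, BoolDist.pure_bind, LMap_natural]

theorem LMap_possComp_dinatural (p : BoolDist (DetProc P P')) (T V : Scenario.{u}) :
    possComp (BoolDist.pure (LMap P' T V))
        (possHomMap (BoolDist.pure (DetProc.id (homScen P' T))) (possHomMap p (BoolDist.pure (DetProc.id V)))) =
      possComp (BoolDist.pure (LMap P T V))
        (possHomMap (possHomMap p (BoolDist.pure (DetProc.id T))) (BoolDist.pure (DetProc.id (homScen P V)))) := by
  simp only [possHomMap, possComp, BoolDist.bind_bind, BoolDist.pure_bind, LMap_dinatural]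

end possibilistic

/-! ### The closed structure on possibilistic procedures -/

namespace PossHom

variable {A B A' B' : GScenario.{u}}

/-- A deterministic procedure that preserves the structure predicates, as a morphism. -/
def ofDet (f : DetProc A.scen B.scen) (hf : DetPreserves A B f) : PossHom A B :=
  ⟨BoolDist.pure f, preserves_pure.2 hf⟩

/-- The action of the internal hom on morphisms. -/
def map (f : PossHom A' A) (g : PossHom B B') : PossHom (homObj A B) (homObj A' B') where
  proc := possHomMap f.proc g.proc
  preserves := preserves_iff.2 fun k hk => by
    obtain ⟨a, ha, hk⟩ := BoolDist.mem_bind.1 hk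
    obtain ⟨b, hb, hk⟩ := BoolDist.mem_bind.1 hk
    obtain rfl : k = DetProc.homMap a b := hk
    exact detPreserves_homMap (preserves_iff.1 f.preserves a ha) (preserves_iff.1 g.preserves b hb)

/-- The point `j_A ; [1, f]` of the internal hom. -/
def point (f : PossHom A B) : PossHom unit (homObj A B) where
  proc := possComp (BoolDist.pure (jMap A.scen)) (possHomMap (BoolDist.pure (DetProc.id A.scen)) f.proc)
  preserves := (preserves_pure.2 (detPreserves_jMap A)).comp (B := homObj A A)
    (map (ofDet (DetProc.id _) (detPreserves_id A)) f).preserves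

theorem point_bijective (A B : GScenario.{u}) :
    Function.Bijective (point : PossHom A B → PossHom unit (homObj A B)) := by
  have key : ∀ f : PossHom A B, f.point.proc = f.proc.bind fun a => BoolDist.pure a.name :=
    fun f => jMap_possComp f.proc
  have hmem : ∀ {α β : Type u} (F : BoolDist α) (n : α → β),
      (F.bind fun a => BoolDist.pure (n a)).1 = n '' F.1 := by
    intro α β F n
    ext b
    exact BoolDist.mem_bind.trans (exists_congr fun a => and_congr_right fun _ => eq_comm)
  constructor
  · intro f g h
    have h1 := (key f).symm.trans ((congrArg PossHom.proc h).trans (key g))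
    refine PossHom.ext (Subtype.ext (name_injective.image_injective ?_))
    rw [← hmem, ← hmem, h1]
  · intro q
    have hq := fun a ha => exists_name (preserves_iff.1 q.preserves a ha)
    obtain ⟨a₀, ha₀⟩ := q.proc.2
    obtain ⟨f₀, rfl, _⟩ := hq a₀ ha₀
    -- For subsets the preimage under `name` serves as the inverse; it is non-empty because some
    -- element of `q` is the name of `f₀`.
    refine ⟨⟨⟨name ⁻¹' q.proc.1, f₀, ha₀⟩, preserves_iff.2 fun f hf =>
      detPreserves_of_name (preserves_iff.1 q.preserves _ hf)⟩, ?_⟩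
    refine PossHom.ext ((key _).trans (Subtype.ext ((hmem _ _).trans ?_)))
    refine Set.image_preimage_eq_of_subset fun a ha => ?_
    obtain ⟨f, hf, _⟩ := hq a ha
    exact ⟨f, hf⟩

/-- The closed structure on scenarios and possibilistic procedures. -/
def closedStructure : ClosedStructure ScenPoss.{u} unit homObj where
  map f g := map f g
  map_id _ _ := PossHom.ext (possHomMap_id _ _)
  map_comp f f' g g' := PossHom.ext (possHomMap_comp f.proc f'.proc g.proc g'.proc)
  i A :=
    { hom := ofDet (iMap _) (detPreserves_iMap A)
      inv := ofDet (iInv _) (detPreserves_iInv A)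
      hom_inv_id := PossHom.ext <|
        (possComp_pure_pure _ _).trans (congrArg BoolDist.pure (iMap_iInv _))
      inv_hom_id := PossHom.ext <|
        (possComp_pure_pure _ _).trans (congrArg BoolDist.pure (iInv_iMap _)) }
  i_natural f := PossHom.ext (possComp_iMap f.proc)
  j A := ofDet (jMap _) (detPreserves_jMap A)
  j_dinatural f := PossHom.ext (jMap_possComp_dinatural f.proc)
  L A B D := ofDet (LMap _ _ _) (detPreserves_LMap A B D)
  L_natural A _ _ _ _ f g := PossHom.ext (LMap_possComp_natural (GScenario.scen A) f.proc g.proc)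
  L_dinatural f B D :=
    PossHom.ext (LMap_possComp_dinatural f.proc (GScenario.scen B) (GScenario.scen D))
  CC1 _ _ := PossHom.ext <| (possComp_pure_pure _ _).trans (congrArg BoolDist.pure (jMap_LMap _ _))
  CC2 _ _ := PossHom.ext <| (congrArg (possComp _) (possHomMap_pure_pure _ _)).trans <|
    (possComp_pure_pure _ _).trans (congrArg BoolDist.pure (LMap_jMap _ _))
  CC3 _ _ _ _ := PossHom.ext <|
    (congrArg (possComp _) ((congrArg (possComp _) (possHomMap_pure_pure _ _)).trans
      (possComp_pure_pure _ _))).trans <|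
    (possComp_pure_pure _ _).trans <| (congrArg BoolDist.pure (LMap_LMap _ _ _ _)).trans <|
    ((congrArg (possComp _) (possHomMap_pure_pure _ _)).trans (possComp_pure_pure _ _)).symm
  CC4 _ _ := PossHom.ext <| (congrArg (possComp _) (possHomMap_pure_pure _ _)).trans <|
    (possComp_pure_pure _ _).trans <| (congrArg BoolDist.pure (LMap_iMap _ _)).trans
    (possHomMap_pure_pure _ _).symm
  CC5 := point_bijective

end PossHom

end ClosedScen

theorem mainTheorem3 :
    (∃ K : ClosedScen.ClosedStructure ClosedScen.ScenProb.{u} ClosedScen.unit ClosedScen.homObj,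
      (∀ {A A' B B' : ClosedScen.ScenProb.{u}} (f : A' ⟶ A) (g : B ⟶ B'),
        (K.map f g).proc =
          f.proc.bind fun a => g.proc.bind fun b => PMF.pure (ClosedScen.DetProc.homMap a b)) ∧
      (∀ A : ClosedScen.ScenProb.{u},
        (K.i A).hom.proc = PMF.pure (ClosedScen.DetProc.iMap A.scen)) ∧
      (∀ A : ClosedScen.ScenProb.{u},
        (K.j A).proc = PMF.pure (ClosedScen.DetProc.jMap A.scen)) ∧
      (∀ A B D : ClosedScen.ScenProb.{u},
        (K.L A B D).proc = PMF.pure (ClosedScen.DetProc.LMap A.scen B.scen D.scen))) ∧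
    (∃ K : ClosedScen.ClosedStructure ClosedScen.ScenPoss.{u} ClosedScen.unit ClosedScen.homObj,
      (∀ {A A' B B' : ClosedScen.ScenPoss.{u}} (f : A' ⟶ A) (g : B ⟶ B'),
        (K.map f g).proc =
          f.proc.bind fun a => g.proc.bind fun b =>
            ClosedScen.BoolDist.pure (ClosedScen.DetProc.homMap a b)) ∧
      (∀ A : ClosedScen.ScenPoss.{u},
        (K.i A).hom.proc = ClosedScen.BoolDist.pure (ClosedScen.DetProc.iMap A.scen)) ∧
      (∀ A : ClosedScen.ScenPoss.{u},
        (K.j A).proc = ClosedScen.BoolDist.pure (ClosedScen.DetProc.jMap A.scen)) ∧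
      (∀ A B D : ClosedScen.ScenPoss.{u},
        (K.L A B D).proc =
          ClosedScen.BoolDist.pure (ClosedScen.DetProc.LMap A.scen B.scen D.scen))) ∧
    (∀ A B : ClosedScen.GScenario.{u},
      (∃ e : ClosedScen.ProbModel A.scen, e.collapse = A.model) →
      ∀ p : PMF (ClosedScen.DetProc A.scen B.scen),
        ClosedScen.Preserves A B (ClosedScen.collapse p) ↔
          ∀ e : ClosedScen.ProbModel A.scen,
            e.Satisfies A.pred → (e.push p).Satisfies B.pred) := by
  refine ⟨⟨ClosedScen.ProbHom.closedStructure, fun _ _ => rfl, fun _ => rfl, fun _ => rfl,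
    fun _ _ _ => rfl⟩, ⟨ClosedScen.PossHom.closedStructure, fun _ _ => rfl, fun _ => rfl,
    fun _ => rfl, fun _ _ _ => rfl⟩, ClosedScen.preserves_collapse_iff⟩
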